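/- **Setting.** For $c\ge 0$ and $\kappa\in\mathbb R$ consider the travelling-wave equation $$icu'+u''+u(1-|u|^2)+\kappa u\,(1-|u|^2)''=0\qquad\text{on }\mathbb R,\tag{TW}$$ in the energy space $\mathcal X(\mathbb R)=\{v\in H^1_{\rm loc}(\mathbb R;\mathbb C):\ 1-|v|^2\in L^2(\mathbb R),\ v'\in L^2(\mathbb R)\}$, whose elements are identified with their continuous representatives. A solution is a function $u\in\mathcal X(\mathbb R)$ such that, with $\langle z,w\rangle=\operatorname{Re}z\operatorname{Re}w+\operatorname{Im}z\operatorname{Im}w$, $$\int_{\mathbb R}\langle icu'+u(1-|u|^2),\phi\rangle-\langle u',\phi'\rangle+2\kappa\langle u,u'\rangle\langle u,\phi\rangle'=0\qquad\text{for all }\phi\in C_0^\infty(\mathbb R;\mathbb C).$$ Write $\eta_u=1-|u|^2$ and $$\Gamma(u)=\{x:|u(x)|^2=\tfrac1{2\kappa}\},\quad \mathcal Z(u)=\{x\notin\Gamma(u):x\text{ is a local extremum of }\eta_u\},\quad \mathcal N(u)=\{x:u\text{ is not differentiable at }x\}.$$ Let $$\mathcal D_1=\{0\le c<\sqrt2,\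 0<\kappa<\tfrac12\},\quad \mathcal D_3=\{c>\sqrt2,\ \kappa>\tfrac12\},\quad \mathcal B_-=\{c=\sqrt2,\ 0<\kappa<\tfrac12\},\quad \mathcal B_+=\{c=\sqrt2,\ \kappa>\tfrac12\},$$ $\tilde{\mathcal D}=\mathcal D_1\cup\mathcal D_3\cup\mathcal B_-\cup\mathcal B_+$ and $\mathcal C=\{c\ge0,\ \kappa=\tfrac12\}$. **Proposition 1.8 (Composite waves).** For every $(c,\kappa)\in\tilde{\mathcal D}\cup\mathcal C$ there is a negative constant $A<1-\frac1{2\kappa}$ such that, for every $\eta_0\in(-\infty,A)$, there exists a solution $u\in\mathcal X(\mathbb R)$ of (TW), unique up to a phase shift $u\mapsto e^{i\varphi}u$ with $\varphi\in\mathbb R$, satisfying $$\mathcal Z(u)=\{0\}\quad\text{and}\quad \eta_u(0)=\eta_0.$$ Moreover $\inf_{\mathbb R}|u|>0$, $\eta_0$ is the global minimum of $\eta_u$, and $\mathcal N(u)$ has exactly two elements. In addition, if $(c,\kappa)\in\tilde{\mathcal D}$, then $\Gamma(u)=\mathcal N(u)$, whereas if $(c,\kappa)\in\mathcal C$, then $u$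 is a compacton, i.e. $\eta_u$ is compactly supported. -/

import Mathlib

open MeasureTheory
open scoped ContDiff

noncomputable section

namespace QuasilinearGP

/-- `0 ≤ c < √2` and `0 < κ < 1/2`. -/
def D₁ : Set (ℝ × ℝ) := {p | 0 ≤ p.1 ∧ p.1 < Real.sqrt 2 ∧ 0 < p.2 ∧ p.2 < 1 / 2}

/-- `c > √2` and `κ > 1/2`. -/
def D₃ : Set (ℝ × ℝ) := {p | Real.sqrt 2 < p.1 ∧ 1 / 2 < p.2}

/-- `c = √2` and `0 < κ < 1/2`. -/
def Bminus : Set (ℝ × ℝ) := {p | p.1 = Real.sqrt 2 ∧ 0 < p.2 ∧ p.2 < 1 / 2}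

/-- `c = √2` and `κ > 1/2`. -/
def Bplus : Set (ℝ × ℝ) := {p | p.1 = Real.sqrt 2 ∧ 1 / 2 < p.2}

/-- The parameter set `D̃ = D₁ ∪ D₃ ∪ B₋ ∪ B₊`. -/
def Dtilde : Set (ℝ × ℝ) := D₁ ∪ D₃ ∪ Bminus ∪ Bplus

/-- The critical set `C`: `c ≥ 0` and `κ = 1/2`. -/
def Ccrit : Set (ℝ × ℝ) := {p | 0 ≤ p.1 ∧ p.2 = 1 / 2}

/-- `g` is the weak (distributional) derivative of `v` on `ℝ`. -/
def HasWeakDeriv (v g : ℝ → ℂ) : Prop :=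
  LocallyIntegrable v volume ∧ LocallyIntegrable g volume ∧
    ∀ φ : ℝ → ℝ, ContDiff ℝ ∞ φ → HasCompactSupport φ →
      ∫ x, deriv φ x • v x = -∫ x, φ x • g x

/-- `v ∈ L²_loc(ℝ)`. -/
def LocL2 (v : ℝ → ℂ) : Prop :=
  ∀ K : Set ℝ, IsCompact K → MemLp v 2 (volume.restrict K)

/-- `v ∈ H¹_loc(ℝ)`. -/
def InH1loc (v : ℝ → ℂ) : Prop :=
  LocL2 v ∧ ∃ g : ℝ → ℂ, HasWeakDeriv v g ∧ LocL2 g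

/-- The intensity profile `η = 1 - |u|²`. -/
def eta (u : ℝ → ℂ) (x : ℝ) : ℝ := 1 - ‖u x‖ ^ 2

/-- The energy space `X(ℝ)`: functions in `H¹_loc(ℝ)` with `1 - |v|² ∈ L²(ℝ)` and
`v' ∈ L²(ℝ)`. Each class of `H¹_loc(ℝ)` contains exactly one continuous function, and an element
of `X(ℝ)` is identified with it; this is what gives a meaning to pointwise values. -/
def InX (v : ℝ → ℂ) : Prop :=
  Continuous v ∧ InH1loc v ∧ MemLp (eta v) 2 volume ∧
    ∃ g : ℝ → ℂ, HasWeakDeriv v g ∧ MemLp g 2 volume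

/-- The nonvanishing energy space `NX(ℝ)`. -/
def InNX (v : ℝ → ℂ) : Prop :=
  InX v ∧ 0 < ⨅ x : ℝ, ‖v x‖

/-- Weak solutions of `i c u' + u'' + u (1 - |u|²) + κ u (1 - |u|²)'' = 0`: with `g = u'`,
`∫ ⟨i c u' + u (1 - |u|²), φ⟩ - ⟨u', φ'⟩ + 2 κ ⟨u, u'⟩ ⟨u, φ⟩' = 0` for all
`φ ∈ C₀^∞(ℝ; ℂ)`, where `⟨z, w⟩ = Re z Re w + Im z Im w` is the real inner product of `ℂ` and
`⟨u, φ⟩' = ⟨u', φ⟩ + ⟨u, φ'⟩`. -/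
def IsWeakSolution (c κ : ℝ) (u : ℝ → ℂ) : Prop :=
  ∃ g : ℝ → ℂ, HasWeakDeriv u g ∧
    ∀ φ : ℝ → ℂ, ContDiff ℝ ∞ φ → HasCompactSupport φ →
      ∫ x, (inner ℝ (Complex.I * (c : ℂ) * g x + u x * ((eta u x : ℝ) : ℂ)) (φ x)
        - inner ℝ (g x) (deriv φ x)
        + 2 * κ * inner ℝ (u x) (g x)
            * (inner ℝ (g x) (φ x) + inner ℝ (u x) (deriv φ x))) = 0

/-- The singular set `Γ(u) = {x : |u(x)|² = 1/(2κ)}`. -/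
def singularSet (κ : ℝ) (u : ℝ → ℂ) : Set ℝ := {x | ‖u x‖ ^ 2 = 1 / (2 * κ)}

/-- `𝒵(u)`: the points outside `Γ(u)` that are local extrema of `1 - |u|²`. -/
def regularExtrema (κ : ℝ) (u : ℝ → ℂ) : Set ℝ :=
  {x | x ∉ singularSet κ u ∧ IsLocalExtr (eta u) x}

/-- `𝒩(u)`: the points where `u` is not differentiable in the classical sense. -/
def nondiffSet (u : ℝ → ℂ) : Set ℝ := {x | ¬ DifferentiableAt ℝ u x}

/-- `u ∈ X(ℝ)` is a solution with `𝒵(u) = {0}` and `η(0) = η₀`. -/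
structure IsCompositeWave (c κ η₀ : ℝ) (u : ℝ → ℂ) : Prop where
  inX : InX u
  sol : IsWeakSolution c κ u
  extrema : regularExtrema κ u = {0}
  value : eta u 0 = η₀

end QuasilinearGP

end

/-
Integrating the weak equation once shows that its solutions are exactly those of a first-order
system for `u`, `u'` and the flux `u' - 2κ⟨u, u'⟩u`, the last of which stays continuous where `u`
is not differentiable. Finite energy forces the momentum identity `⟨iu, u'⟩ = cη/2`, which reduces
the problem to the intensity `η` and its first integral
`(1 - 2κ(1 - η)) η'² = η² (2 - c² - 2η) + K (1 - η)`. Between the two crossings, where `η`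
reaches its singular value `1 - 1/(2κ)`, the constant `K` is determined by `η₀`; outside them finite
energy gives `K = 0`, so that there `η` is an explicit tail, identically zero when `κ = 1/2`.

Both branches are written explicitly in a desingularising parameter `p`, with `dx/dp` read off the
first integral. This speed vanishes at the crossing, so the inverse of the clock `x(p)` is a
profile with a vertical tangent there, where `u` stops being differentiable. Conversely, the
parameter read off from the intensity of any composite wave moves at the same speed, so its
intensity is the profile; then `u' / u` is determined, and `u` is unique up to a constant phase.
-/

namespace QuasilinearGP

open Set Filter Topology

section AEDeriv

variable {E F : Type*} [NormedAddCommGroup E] [NormedAddCommGroup F]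

theorem intervalIntegrable_of_locallyIntegrable {f : ℝ → E} (hf : LocallyIntegrable f volume)
    (a b : ℝ) : IntervalIntegrable f volume a b :=
  intervalIntegrable_iff.mpr <|
    (hf.integrableOn_isCompact isCompact_uIcc).mono_set uIoc_subset_uIcc

variable [NormedSpace ℝ E] [NormedSpace ℝ F]

theorem locallyIntegrable_clm_comp {f : ℝ → E} (L : E →L[ℝ] F)
    (hf : LocallyIntegrable f volume) : LocallyIntegrable (fun x => L (f x)) volume := fun x =>
  (hf x).imp fun _ hs => ⟨hs.1, L.integrable_comp hs.2⟩

/-- `f` is a primitive of `f'` in the sense of Lebesgue: `f` is locally absolutely continuous and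
`f'` is its derivative almost everywhere. Absolute continuity is encoded by the fundamental theorem
of calculus. -/
structure HasAEDeriv (f f' : ℝ → E) : Prop where
  intervalIntegrable : ∀ a b, IntervalIntegrable f' volume a b
  integral_eq_sub : ∀ a b, ∫ x in a..b, f' x = f b - f a

namespace HasAEDeriv

variable {f f' g g' : ℝ → E}

theorem eq_add_integral (hf : HasAEDeriv f f') (a x : ℝ) : f x = f a + ∫ t in a..x, f' t := by
  rw [hf.integral_eq_sub, add_sub_cancel]

theorem locallyIntegrable (hf : HasAEDeriv f f') : LocallyIntegrable f' volume := fun x =>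
  ⟨Ioc (x - 1) (x + 1), Ioc_mem_nhds (by linarith) (by linarith),
    (intervalIntegrable_iff_integrableOn_Ioc_of_le (by linarith)).1 (hf.intervalIntegrable _ _)⟩

theorem continuous (hf : HasAEDeriv f f') : Continuous f := by
  rw [funext (hf.eq_add_integral 0)]
  exact continuous_const.add (intervalIntegral.continuous_primitive hf.intervalIntegrable 0)

theorem ae_hasDerivAt [CompleteSpace E] (hf : HasAEDeriv f f') :
    ∀ᵐ x, HasDerivAt f (f' x) x := by
  filter_upwards [_root_.LocallyIntegrable.ae_hasDerivAt_integral hf.locallyIntegrable] with x hx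
  rw [funext (hf.eq_add_integral 0)]
  exact (hx 0).const_add _

theorem congr_ae (hf : HasAEDeriv f f') (h : f' =ᵐ[volume] g') : HasAEDeriv f g' where
  intervalIntegrable a b := (hf.intervalIntegrable a b).congr_ae (ae_restrict_of_ae h)
  integral_eq_sub a b := by
    rw [← hf.integral_eq_sub]
    exact intervalIntegral.integral_congr_ae (h.mono fun x hx _ => hx.symm)

theorem const (e : E) : HasAEDeriv (fun _ => e) (fun _ => 0) :=
  ⟨fun _ _ => by simp, fun _ _ => by simp⟩

theorem integral (hf : ∀ a b, IntervalIntegrable f volume a b) (a : ℝ) :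
    HasAEDeriv (fun x => ∫ t in a..x, f t) f :=
  ⟨hf, fun b x => (intervalIntegral.integral_interval_sub_left (hf a x) (hf a b)).symm⟩

theorem of_hasDerivAt_off_countable [CompleteSpace E] {s : Set ℝ} (hs : s.Countable)
    (hc : Continuous f) (hf : ∀ x ∉ s, HasDerivAt f (f' x) x)
    (hf' : LocallyIntegrable f' volume) : HasAEDeriv f f' where
  intervalIntegrable := intervalIntegrable_of_locallyIntegrable hf'
  integral_eq_sub a b := MeasureTheory.integral_eq_of_hasDerivAt_off_countable f f' hs
    hc.continuousOn (fun x hx => hf x hx.2) (intervalIntegrable_of_locallyIntegrable hf' a b)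

theorem of_contDiff [CompleteSpace E] (hf : ContDiff ℝ ∞ f) : HasAEDeriv f (deriv f) :=
  of_hasDerivAt_off_countable countable_empty hf.continuous
    (fun x _ => (hf.differentiable (by simp) x).hasDerivAt)
    (hf.continuous_deriv (by simp)).locallyIntegrable

theorem add (hf : HasAEDeriv f f') (hg : HasAEDeriv g g') :
    HasAEDeriv (fun x => f x + g x) (fun x => f' x + g' x) where
  intervalIntegrable a b := (hf.intervalIntegrable a b).add (hg.intervalIntegrable a b)
  integral_eq_sub a b := by
    rw [intervalIntegral.integral_add (hf.intervalIntegrable a b) (hg.intervalIntegrable a b),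
      hf.integral_eq_sub, hg.integral_eq_sub, add_sub_add_comm]

theorem clm_comp [CompleteSpace E] [CompleteSpace F] (L : E →L[ℝ] F) (hf : HasAEDeriv f f') :
    HasAEDeriv (fun x => L (f x)) (fun x => L (f' x)) where
  intervalIntegrable a b :=
    ⟨L.integrable_comp (hf.intervalIntegrable a b).1,
      L.integrable_comp (hf.intervalIntegrable a b).2⟩
  integral_eq_sub a b := by
    rw [L.intervalIntegral_comp_comm (hf.intervalIntegrable a b), hf.integral_eq_sub, map_sub]

theorem const_smul [CompleteSpace E] (r : ℝ) (hf : HasAEDeriv f f') :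
    HasAEDeriv (fun x => r • f x) (fun x => r • f' x) :=
  hf.clm_comp (r • ContinuousLinearMap.id ℝ E)

theorem sub [CompleteSpace E] (hf : HasAEDeriv f f') (hg : HasAEDeriv g g') :
    HasAEDeriv (fun x => f x - g x) (fun x => f' x - g' x) := by
  simpa only [neg_smul, one_smul, ← sub_eq_add_neg] using hf.add (hg.const_smul (-1))

theorem comp_neg (hf : HasAEDeriv f f') : HasAEDeriv (fun x => f (-x)) (fun x => -f' (-x)) where
  intervalIntegrable a b := by
    have h := (hf.intervalIntegrable (-a) (-b)).comp_mul_left (c := -1)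
    simp only [neg_one_mul, div_neg, div_one, neg_neg] at h
    exact h.neg
  integral_eq_sub a b := by
    rw [intervalIntegral.integral_neg, intervalIntegral.integral_comp_neg, hf.integral_eq_sub,
      neg_sub]

theorem eq_of_ae_eq_zero (hf : HasAEDeriv f f') (h : f' =ᵐ[volume] 0) (x y : ℝ) : f x = f y := by
  rw [hf.eq_add_integral y x, intervalIntegral.integral_zero_ae (h.mono fun _ hx _ => hx), add_zero]

theorem hasDerivAt_of_ae_eq [CompleteSpace E] {U : Set ℝ} (hf : HasAEDeriv f f') (hU : IsOpen U)
    (hg : ContinuousOn g U) (h : ∀ᵐ x, x ∈ U → f' x = g x) {x : ℝ} (hx : x ∈ U) :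
    HasDerivAt f (g x) x := by
  obtain ⟨ε, hε, hb⟩ := Metric.isOpen_iff.1 hU x hx
  have hgx : ContinuousAt g x := hg.continuousAt (hU.mem_nhds hx)
  have hint : HasDerivAt (fun y => ∫ t in x..y, g t) (g x) x :=
    intervalIntegral.integral_hasDerivAt_right (by simp) (hg.stronglyMeasurableAtFilter hU x hx) hgx
  refine (hint.const_add (f x)).congr_of_eventuallyEq ?_
  filter_upwards [Metric.ball_mem_nhds x hε] with y hy
  have hxy : uIcc x y ⊆ U :=
    ((convex_ball x ε).ordConnected.uIcc_subset (Metric.mem_ball_self hε) hy).trans hb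
  rw [hf.eq_add_integral x y]
  congr 1
  exact intervalIntegral.integral_congr_ae (h.mono fun t ht hty => ht (hxy (uIoc_subset_uIcc hty)))

theorem absolutelyContinuousOnInterval {f f' : ℝ → ℝ} (hf : HasAEDeriv f f') (a b : ℝ) :
    AbsolutelyContinuousOnInterval f a b := by
  rw [funext (hf.eq_add_integral a)]
  have hconst : AbsolutelyContinuousOnInterval (fun _ : ℝ => f a) a b :=
    contDiffOn_const.absolutelyContinuousOnInterval
  exact hconst.add
    ((hf.intervalIntegrable a b).absolutelyContinuousOnInterval_intervalIntegral left_mem_uIcc)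

theorem mul {f f' g g' : ℝ → ℝ} (hf : HasAEDeriv f f') (hg : HasAEDeriv g g') :
    HasAEDeriv (fun x => f x * g x) (fun x => f' x * g x + f x * g' x) where
  intervalIntegrable a b :=
    ((hf.intervalIntegrable a b).mul_continuousOn hg.continuous.continuousOn).add
      ((hg.intervalIntegrable a b).continuousOn_mul hf.continuous.continuousOn)
  integral_eq_sub a b := by
    rw [← (hf.absolutelyContinuousOnInterval a b).integral_deriv_mul_eq_sub
      (hg.absolutelyContinuousOnInterval a b)]
    refine intervalIntegral.integral_congr_ae ?_
    filter_upwards [hf.ae_hasDerivAt, hg.ae_hasDerivAt] with x hfx hgx _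
    rw [hfx.deriv, hgx.deriv]

theorem inner {f f' g g' : ℝ → ℂ} (hf : HasAEDeriv f f') (hg : HasAEDeriv g g') :
    HasAEDeriv (fun x => inner ℝ (f x) (g x))
      (fun x => inner ℝ (f' x) (g x) + inner ℝ (f x) (g' x)) := by
  have hre := (hf.clm_comp Complex.reCLM).mul (hg.clm_comp Complex.reCLM)
  have him := (hf.clm_comp Complex.imCLM).mul (hg.clm_comp Complex.imCLM)
  convert hre.add him using 2 <;>
    simp only [Complex.inner, Complex.mul_re, Complex.conj_re, Complex.conj_im,
      Complex.reCLM_apply, Complex.imCLM_apply] <;> ring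

theorem smul {f f' : ℝ → ℝ} {g g' : ℝ → ℂ} (hf : HasAEDeriv f f') (hg : HasAEDeriv g g') :
    HasAEDeriv (fun x => f x • g x) (fun x => f' x • g x + f x • g' x) := by
  have hre := (hf.mul (hg.clm_comp Complex.reCLM)).clm_comp Complex.ofRealCLM
  have him := (hf.mul (hg.clm_comp Complex.imCLM)).clm_comp
    (Complex.ofRealCLM.smulRight Complex.I)
  convert hre.add him using 2 <;> apply Complex.ext <;> simp

end HasAEDeriv

theorem integral_eq_zero_of_intervalIntegral_eq_sub {f f' : ℝ → E} (hc : HasCompactSupport f)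
    (hi : Integrable f') (h : ∀ a b, ∫ x in a..b, f' x = f b - f a) : ∫ x, f' x = 0 := by
  obtain ⟨L, -, hL⟩ := hc.exists_pos_le_norm
  simp only [Real.norm_eq_abs] at hL
  refine tendsto_nhds_unique
    (intervalIntegral_tendsto_integral hi tendsto_neg_atTop_atBot tendsto_id)
    (tendsto_const_nhds.congr' ?_)
  filter_upwards [eventually_ge_atTop L, eventually_ge_atTop 0] with x hxL hx0
  rw [id, h, hL x (by rwa [abs_of_nonneg hx0]), hL (-x) (by rwa [abs_neg, abs_of_nonneg hx0]),
    sub_zero]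

theorem eqOn_of_hasDerivAt_zero_off_countable [CompleteSpace E] {f : ℝ → E} {s : Set ℝ} {a b : ℝ}
    (hs : s.Countable) (hf : ContinuousOn f (Icc a b))
    (hd : ∀ x ∈ Ioo a b \ s, HasDerivAt f 0 x) {x : ℝ} (hx : x ∈ Icc a b) : f x = f a := by
  have hsub : uIcc a x ⊆ Icc a b := by
    rw [uIcc_of_le hx.1]; exact Icc_subset_Icc_right hx.2
  have h := integral_eq_of_hasDerivAt_off_countable f (fun _ => 0) hs (hf.mono hsub)
    (fun z hz => hd z ⟨?_, hz.2⟩) (by simp)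
  · rw [intervalIntegral.integral_zero] at h
    exact (sub_eq_zero.1 h.symm)
  · rw [min_eq_left hx.1, max_eq_right hx.1] at hz
    exact ⟨hz.1.1, hz.1.2.trans_le hx.2⟩

end AEDeriv

theorem exists_contDiff_primitive {ψ : ℝ → ℝ} (hψ : ContDiff ℝ ∞ ψ) (hc : HasCompactSupport ψ)
    (h0 : ∫ x, ψ x = 0) :
    ∃ φ : ℝ → ℝ, ContDiff ℝ ∞ φ ∧ HasCompactSupport φ ∧ deriv φ = ψ := by
  obtain ⟨L, -, hL⟩ := hc.exists_pos_le_norm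
  simp only [Real.norm_eq_abs] at hL
  let φ : ℝ → ℝ := fun x => ∫ t in (-L)..x, ψ t
  have hd : ∀ x, HasDerivAt φ (ψ x) x := fun x => hψ.continuous.integral_hasStrictDerivAt _ _
    |>.hasDerivAt
  have hder : deriv φ = ψ := funext fun x => (hd x).deriv
  refine ⟨φ, contDiff_infty_iff_deriv.2 ⟨fun x => (hd x).differentiableAt, hder ▸ hψ⟩, ?_, hder⟩
  refine HasCompactSupport.intro (K := Icc (-L) L) isCompact_Icc fun x hx => ?_
  have hx' : x < -L ∨ L < x := by
    by_contra! h
    exact hx h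
  rcases hx' with hx' | hx'
  · refine intervalIntegral.integral_zero_ae (Eventually.of_forall fun t ht => hL t ?_)
    rw [uIoc_of_ge hx'.le] at ht
    linarith [ht.2, neg_le_abs t]
  · rw [← h0]
    refine intervalIntegral.integral_eq_integral_of_support_subset fun t ht => ?_
    have htL : |t| < L := not_le.1 fun h => ht (hL t h)
    exact ⟨(abs_lt.1 htL).1, (abs_lt.1 htL).2.le.trans hx'.le⟩

theorem ae_eq_const_of_forall_integral_deriv_mul_eq_zero {w : ℝ → ℝ}
    (hw : LocallyIntegrable w volume)
    (h : ∀ φ : ℝ → ℝ, ContDiff ℝ ∞ φ → HasCompactSupport φ → ∫ x, deriv φ x * w x = 0) :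
    ∃ C : ℝ, ∀ᵐ x, w x = C := by
  let b : ContDiffBump (0 : ℝ) := default
  let ψ : ℝ → ℝ := b.normed volume
  have hψ : ContDiff ℝ ∞ ψ := b.contDiff_normed
  have hψc : HasCompactSupport ψ := b.hasCompactSupport_normed
  have hψ1 : ∫ x, ψ x = 1 := b.integral_normed
  have hint : ∀ {g : ℝ → ℝ}, ContDiff ℝ ∞ g → HasCompactSupport g →
      Integrable (fun x => g x * w x) := fun hg hc =>
    hw.integrable_smul_left_of_hasCompactSupport hg.continuous hc
  refine ⟨∫ x, ψ x * w x,
    ae_eq_of_integral_contDiff_smul_eq hw continuous_const.locallyIntegrable fun g hg hc => ?_⟩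
  have hgi : Integrable g := hg.continuous.integrable_of_hasCompactSupport hc
  have hψi : Integrable ψ := hψ.continuous.integrable_of_hasCompactSupport hψc
  obtain ⟨φ, hφ, hφc, hφd⟩ := exists_contDiff_primitive (ψ := fun x => g x - (∫ y, g y) * ψ x)
    (hg.sub (contDiff_const.mul hψ)) (hc.sub hψc.mul_left) (by
      rw [integral_sub hgi (hψi.const_mul _), integral_const_mul, hψ1, mul_one, sub_self])
  have hφw := h φ hφ hφc
  simp only [hφd, sub_mul, mul_assoc] at hφw
  rw [integral_sub (hint hg hc) ((hint hψ hψc).const_mul _), integral_const_mul,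
    sub_eq_zero] at hφw
  simp only [smul_eq_mul, integral_mul_const, hφw]

theorem exists_hasAEDeriv_of_forall_integral_deriv_mul {w F : ℝ → ℝ}
    (hw : LocallyIntegrable w volume) (hF : LocallyIntegrable F volume)
    (h : ∀ φ : ℝ → ℝ, ContDiff ℝ ∞ φ → HasCompactSupport φ →
      ∫ x, deriv φ x * w x = -∫ x, φ x * F x) :
    ∃ P : ℝ → ℝ, HasAEDeriv P F ∧ w =ᵐ[volume] P := by
  let Q : ℝ → ℝ := fun x => ∫ t in (0 : ℝ)..x, F t
  have hQ : HasAEDeriv Q F := .integral (intervalIntegrable_of_locallyIntegrable hF) 0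
  have hQl : LocallyIntegrable Q volume := hQ.continuous.locallyIntegrable
  obtain ⟨C, hC⟩ := ae_eq_const_of_forall_integral_deriv_mul_eq_zero (hw.sub hQl)
    fun φ hφ hφc => by
      have hφ' : Continuous (deriv φ) := hφ.continuous_deriv (by simp)
      have hφw : Integrable (fun x => deriv φ x * w x) :=
        hw.integrable_smul_left_of_hasCompactSupport hφ' hφc.deriv
      have hφQ : Integrable (fun x => deriv φ x * Q x) :=
        hQl.integrable_smul_left_of_hasCompactSupport hφ' hφc.deriv
      have hφF : Integrable (fun x => φ x * F x) :=
        hF.integrable_smul_left_of_hasCompactSupport hφ.continuous hφc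
      have hmul := (HasAEDeriv.of_contDiff hφ).mul hQ
      have hparts : ∫ x, (deriv φ x * Q x + φ x * F x) = 0 :=
        integral_eq_zero_of_intervalIntegral_eq_sub (f := fun x => φ x * Q x) hφc.mul_right
          (hφQ.add hφF) hmul.integral_eq_sub
      rw [integral_add hφQ hφF] at hparts
      simp only [Pi.sub_apply, mul_sub]
      rw [integral_sub hφw hφQ, h φ hφ hφc]
      linarith
  refine ⟨fun x => C + Q x, by simpa only [zero_add] using (HasAEDeriv.const C).add hQ, ?_⟩
  filter_upwards [hC] with x hx
  rw [← hx, Pi.sub_apply, sub_add_cancel]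

theorem HasWeakDeriv.exists_hasAEDeriv {v g : ℝ → ℂ} (h : HasWeakDeriv v g) :
    ∃ P : ℝ → ℂ, HasAEDeriv P g ∧ v =ᵐ[volume] P := by
  obtain ⟨hv, hg, hvg⟩ := h
  have component : ∀ L : ℂ →L[ℝ] ℝ,
      ∃ P : ℝ → ℝ, HasAEDeriv P (fun x => L (g x)) ∧ (fun x => L (v x)) =ᵐ[volume] P := by
    intro L
    refine exists_hasAEDeriv_of_forall_integral_deriv_mul (locallyIntegrable_clm_comp L hv)
      (locallyIntegrable_clm_comp L hg) fun φ hφ hφc => ?_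
    have hφv : Integrable (fun x => deriv φ x • v x) :=
      hv.integrable_smul_left_of_hasCompactSupport (hφ.continuous_deriv (by simp)) hφc.deriv
    have hφg : Integrable (fun x => φ x • g x) :=
      hg.integrable_smul_left_of_hasCompactSupport hφ.continuous hφc
    have := congrArg L (hvg φ hφ hφc)
    rw [← L.integral_comp_comm hφv, map_neg, ← L.integral_comp_comm hφg] at this
    simpa only [map_smul, smul_eq_mul] using this
  obtain ⟨P, hP, hvP⟩ := component Complex.reCLM
  obtain ⟨Q, hQ, hvQ⟩ := component Complex.imCLM
  refine ⟨fun x => P x + Complex.I * Q x, ?_, ?_⟩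
  · refine ((hP.clm_comp Complex.ofRealCLM).add ((hQ.clm_comp Complex.ofRealCLM).clm_comp
      (ContinuousLinearMap.mul ℝ ℂ Complex.I))).congr_ae (Eventually.of_forall fun x => ?_)
    exact (mul_comm Complex.I _ ▸ Complex.re_add_im (g x) :)
  · filter_upwards [hvP, hvQ] with x hxP hxQ
    rw [← hxP, ← hxQ, mul_comm]
    exact (Complex.re_add_im (v x)).symm

theorem HasAEDeriv.hasWeakDeriv {v g : ℝ → ℂ} (h : HasAEDeriv v g) : HasWeakDeriv v g := by
  have hv := h.continuous.locallyIntegrable (μ := volume)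
  refine ⟨hv, h.locallyIntegrable, fun φ hφ hφc => ?_⟩
  have hφv : Integrable (fun x => deriv φ x • v x) :=
    hv.integrable_smul_left_of_hasCompactSupport (hφ.continuous_deriv (by simp)) hφc.deriv
  have hφg : Integrable (fun x => φ x • g x) :=
    h.locallyIntegrable.integrable_smul_left_of_hasCompactSupport hφ.continuous hφc
  rw [eq_neg_iff_add_eq_zero, ← integral_add hφv hφg]
  exact integral_eq_zero_of_intervalIntegral_eq_sub (f := fun x => φ x • v x) hφc.smul_right
    (hφv.add hφg) ((HasAEDeriv.of_contDiff hφ).smul h).integral_eq_sub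

theorem nonpos_of_le_integrable {f G : ℝ → ℝ} {a k : ℝ} (hf : Integrable (fun x => f x ^ 2))
    (hG : Integrable G) (h : ∀ᵐ x, a < x → |f x| ≤ 1 → k ≤ G x) : k ≤ 0 := by
  by_contra! hk
  have hbound : ∀ᵐ x, x ∈ Ioi a → ‖k‖ ≤ |G x| + k * f x ^ 2 := by
    filter_upwards [h] with x hx hxa
    rw [Real.norm_of_nonneg hk.le]
    rcases le_or_gt |f x| 1 with hf1 | hf1
    · have := hx hxa hf1
      have := le_abs_self (G x)
      nlinarith [mul_nonneg hk.le (sq_nonneg (f x))]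
    · have : 1 ≤ f x ^ 2 := by rw [← sq_abs]; nlinarith
      nlinarith [abs_nonneg (G x)]
  have hconst : IntegrableOn (fun _ : ℝ => k) (Ioi a) :=
    (hG.abs.add (hf.const_mul k)).integrableOn.mono' (by fun_prop)
      ((ae_restrict_iff' measurableSet_Ioi).2 hbound)
  simp [integrableOn_const_iff, hk.ne'] at hconst

/-- The time change with speed `Ψ = dx/dp`: the position `x` at the parameter value `p`. -/
noncomputable def clock (Ψ : ℝ → ℝ) (p : ℝ) : ℝ := ∫ t in (0 : ℝ)..p, Ψ t

section Clock

variable {Ψ : ℝ → ℝ}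

theorem hasDerivAt_clock (hc : Continuous Ψ) (p : ℝ) : HasDerivAt (clock Ψ) (Ψ p) p :=
  (hc.integral_hasStrictDerivAt 0 p).hasDerivAt

theorem continuous_clock (hc : Continuous Ψ) : Continuous (clock Ψ) :=
  continuous_iff_continuousAt.2 fun p => (hasDerivAt_clock hc p).continuousAt

theorem clock_zero (Ψ : ℝ → ℝ) : clock Ψ 0 = 0 := intervalIntegral.integral_same

theorem clock_sub_clock (hc : Continuous Ψ) (a b : ℝ) :
    clock Ψ b - clock Ψ a = ∫ t in a..b, Ψ t :=
  intervalIntegral.integral_interval_sub_left (hc.intervalIntegrable _ _)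
    (hc.intervalIntegrable _ _)

theorem clock_neg (he : ∀ p, Ψ (-p) = Ψ p) (p : ℝ) : clock Ψ (-p) = -clock Ψ p := by
  have h := intervalIntegral.integral_comp_neg (a := 0) (b := p) Ψ
  simp only [he, neg_zero] at h
  rw [clock, clock, h, intervalIntegral.integral_symm]

theorem strictMono_clock {T : ℝ} (hc : Continuous Ψ) (h0 : ∀ p, 0 ≤ Ψ p)
    (hz : ∀ p, Ψ p = 0 → |p| = T) : StrictMono (clock Ψ) := by
  intro a b hab
  rw [← sub_pos, clock_sub_clock hc]
  refine intervalIntegral.integral_pos hab hc.continuousOn (fun x _ => h0 x) ?_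
  obtain ⟨x, hx, hxT⟩ := ((Ioo_infinite hab).sdiff (toFinite {T, -T})).nonempty
  refine ⟨x, Ioo_subset_Icc_self hx, (h0 x).lt_of_ne fun h => hxT ?_⟩
  exact (abs_eq (hz x h.symm ▸ abs_nonneg x)).1 (hz x h.symm)

theorem tendsto_clock_atTop {δ M : ℝ} (hc : Continuous Ψ) (hδ : 0 < δ)
    (hM : ∀ p, M ≤ p → δ ≤ Ψ p) : Tendsto (clock Ψ) atTop atTop := by
  have hlin : Tendsto (fun p : ℝ => clock Ψ M + δ * (p - M)) atTop atTop :=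
    tendsto_atTop_add_const_left _ _
      ((tendsto_atTop_add_const_right _ _ tendsto_id).const_mul_atTop hδ)
  refine tendsto_atTop_mono' _ ?_ hlin
  filter_upwards [eventually_ge_atTop M] with p hp
  have hle : ∫ _ in M..p, δ ≤ ∫ t in M..p, Ψ t :=
    intervalIntegral.integral_mono_on hp (by simp) (hc.intervalIntegrable _ _)
      fun t ht => hM t ht.1
  rw [intervalIntegral.integral_const, smul_eq_mul, ← clock_sub_clock hc] at hle
  linarith

theorem exists_inverse_clock {T : ℝ} (hc : Continuous Ψ) (he : ∀ p, Ψ (-p) = Ψ p)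
    (h0 : ∀ p, 0 ≤ Ψ p) (hz : ∀ p, Ψ p = 0 → |p| = T) (htop : Tendsto (clock Ψ) atTop atTop) :
    ∃ P : ℝ → ℝ, Continuous P ∧ StrictMono P ∧ (∀ x, clock Ψ (P x) = x) ∧
      (∀ p, P (clock Ψ p) = p) ∧ (∀ x, P (-x) = -P x) ∧
      ∀ x, Ψ (P x) ≠ 0 → HasDerivAt P (Ψ (P x))⁻¹ x := by
  have hbot : Tendsto (clock Ψ) atBot atBot := by
    rw [show clock Ψ = fun p => -clock Ψ (-p) from funext fun p => by rw [clock_neg he, neg_neg]]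
    exact tendsto_neg_atTop_atBot.comp (htop.comp tendsto_neg_atBot_atTop)
  let e := (strictMono_clock hc h0 hz).orderIsoOfSurjective _
    ((continuous_clock hc).surjective htop hbot)
  have hright : ∀ x, clock Ψ (e.symm x) = x := e.apply_symm_apply
  have hleft : ∀ p, e.symm (clock Ψ p) = p := e.symm_apply_apply
  refine ⟨e.symm, e.symm.continuous, e.symm.strictMono, hright, hleft, fun x => ?_, fun x hx => ?_⟩
  · rw [← hleft (-e.symm x), clock_neg he, hright]
  · exact HasDerivAt.of_local_left_inverse e.symm.continuous.continuousAt
      (hasDerivAt_clock hc _) hx (Eventually.of_forall hright)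

end Clock

/-- The value of `η` on the singular set. -/
noncomputable def etaStar (κ : ℝ) : ℝ := 1 - 1 / (2 * κ)

/-- The coefficient `1 - 2κ(1 - η)` of the second derivative in the equation for `η`; it vanishes
exactly on the singular set. -/
noncomputable def diffusion (κ η : ℝ) : ℝ := 1 - 2 * κ + 2 * κ * η

/-- The derivative of the flux `(1 - 2κ(1 - η)) η'` along solutions, in terms of `η` and
`d = η'`. -/
noncomputable def fluxDeriv (c κ η d : ℝ) : ℝ :=
  -(d ^ 2 + c ^ 2 * η ^ 2) / (2 * (1 - η)) + 2 * κ * d ^ 2 - c ^ 2 * η + 2 * (1 - η) * η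

/-- The factor of the first integral in a region where the solution may tend to `0`. -/
noncomputable def outerFactor (c η : ℝ) : ℝ := 2 - c ^ 2 - 2 * η

/-- The potential of the first integral `(1 - 2κ(1 - η)) η'² = η² (2 - c² - 2η) + K (1 - η)`, where
`K` is a constant of integration. -/
noncomputable def potential (c K η : ℝ) : ℝ := η ^ 2 * outerFactor c η + K * (1 - η)

/-- The value of the constant of integration for which `potential c K` vanishes at `η₀`. -/
noncomputable def innerLevel (c η₀ : ℝ) : ℝ := -(η₀ ^ 2 * outerFactor c η₀) / (1 - η₀)

/-- The cofactor of `η₀ - η` in `potential c (innerLevel c η₀) η`. -/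
noncomputable def innerFactor (c η₀ η : ℝ) : ℝ :=
  (-2 * (η₀ + η) - c ^ 2) * (1 - η) + c ^ 2 / (1 - η₀)

/-- The admissible parameters, with a depth `η₀` below an explicit threshold. -/
structure Admissible (c κ η₀ : ℝ) : Prop where
  pos : 0 < κ
  sub : κ < 1 / 2 → c ^ 2 ≤ 2
  super : 1 / 2 < κ → 2 ≤ c ^ 2
  depth : η₀ < min (etaStar κ) 0 - c ^ 2 - 2

/-- The parameter at which the profile reaches the singular value. -/
noncomputable def crossing (κ η₀ : ℝ) : ℝ := √(etaStar κ - η₀)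

/-- The profile `η` as a function of a parameter `p` in which it is smooth up to the singular value
from both sides. -/
noncomputable def profEta (κ η₀ p : ℝ) : ℝ :=
  if |p| ≤ crossing κ η₀ then η₀ + p ^ 2 else etaStar κ * Real.exp (crossing κ η₀ - |p|)

/-- The rate `dx/dp` of the parameter of `profEta`, read off the first integral. For `κ = 1/2` the
profile vanishes outside and the rate there is an arbitrary choice. -/
noncomputable def profRate (c κ η₀ p : ℝ) : ℝ :=
  if |p| ≤ crossing κ η₀ then
    2 * √(-diffusion κ (profEta κ η₀ p) / innerFactor c η₀ (profEta κ η₀ p))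
  else if κ = 1 / 2 then |p| - crossing κ η₀
  else √(diffusion κ (profEta κ η₀ p) / outerFactor c (profEta κ η₀ p))

/-- The flux `(1 - 2κ(1 - η)) η'` in the parameter of `profEta`. -/
noncomputable def profFlux (c κ η₀ p : ℝ) : ℝ :=
  if |p| ≤ crossing κ η₀ then
    -p * √(-diffusion κ (profEta κ η₀ p) * innerFactor c η₀ (profEta κ η₀ p))
  else p / |p| * |profEta κ η₀ p| *
    √(diffusion κ (profEta κ η₀ p) * outerFactor c (profEta κ η₀ p))

/-- The derivative `η' = dη/dx` in the parameter of `profEta`. It is `0` by convention where the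
diffusion vanishes. -/
noncomputable def profSlope (c κ η₀ p : ℝ) : ℝ := profFlux c κ η₀ p / diffusion κ (profEta κ η₀ p)

section Profile

variable {c κ η₀ p r : ℝ}

theorem etaStar_lt_one (hκ : 0 < κ) : etaStar κ < 1 := by
  unfold etaStar
  linarith [show 0 < 1 / (2 * κ) by positivity]

theorem two_mul_etaStar (hκ : 0 < κ) : 2 * κ * etaStar κ = 2 * κ - 1 := by
  unfold etaStar
  field_simp

theorem diffusion_eq (hκ : 0 < κ) (η : ℝ) : diffusion κ η = 2 * κ * (η - etaStar κ) := by
  unfold diffusion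
  linear_combination two_mul_etaStar hκ

theorem diffusion_etaStar (hκ : 0 < κ) : diffusion κ (etaStar κ) = 0 := by
  rw [diffusion_eq hκ, sub_self, mul_zero]

theorem diffusion_etaStar_mul (hκ : 0 < κ) (r : ℝ) :
    diffusion κ (etaStar κ * r) = (1 - 2 * κ) * (1 - r) := by
  unfold diffusion
  linear_combination r * two_mul_etaStar hκ

theorem etaStar_ne_zero (hκ : 0 < κ) (hκ' : κ ≠ 1 / 2) : etaStar κ ≠ 0 := fun h => by
  have := two_mul_etaStar hκ
  rw [h, mul_zero] at this
  exact hκ' (by linarith)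

theorem etaStar_half : etaStar (1 / 2) = 0 := by norm_num [etaStar]

theorem etaStar_mul_mul_diffusion_neg (hκ : 0 < κ) (hκ' : κ ≠ 1 / 2) (hr : 0 < r) (hr1 : r < 1) :
    etaStar κ * r * diffusion κ (etaStar κ * r) < 0 := by
  have hsq : 0 < etaStar κ ^ 2 := by have := etaStar_ne_zero hκ hκ'; positivity
  have hpos := mul_pos (mul_pos (mul_pos two_pos hκ) hsq) (mul_pos hr (sub_pos.2 hr1))
  rw [diffusion_etaStar_mul hκ]
  linear_combination hpos + etaStar κ * r * (1 - r) * two_mul_etaStar hκ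

@[fun_prop]
theorem continuous_diffusion : Continuous (diffusion κ) := by unfold diffusion; fun_prop

@[fun_prop]
theorem continuous_outerFactor : Continuous (outerFactor c) := by unfold outerFactor; fun_prop

@[fun_prop]
theorem continuous_innerFactor : Continuous (innerFactor c η₀) := by unfold innerFactor; fun_prop

theorem potential_zero_level (c η : ℝ) : potential c 0 η = η ^ 2 * outerFactor c η := by
  rw [potential, zero_mul, add_zero]

theorem potential_innerLevel (h : η₀ ≠ 1) (η : ℝ) :
    potential c (innerLevel c η₀) η = (η₀ - η) * innerFactor c η₀ η := by
  have : 1 - η₀ ≠ 0 := sub_ne_zero.2 h.symm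
  unfold potential innerLevel outerFactor innerFactor
  field_simp
  ring

theorem profEta_of_le (hp : |p| ≤ crossing κ η₀) : profEta κ η₀ p = η₀ + p ^ 2 := if_pos hp

theorem profEta_of_lt (hp : crossing κ η₀ < |p|) :
    profEta κ η₀ p = etaStar κ * Real.exp (crossing κ η₀ - |p|) := if_neg hp.not_ge

theorem profEta_neg (p : ℝ) : profEta κ η₀ (-p) = profEta κ η₀ p := by
  simp only [profEta, abs_neg, neg_sq]

theorem profRate_neg (p : ℝ) : profRate c κ η₀ (-p) = profRate c κ η₀ p := by
  simp only [profRate, profEta_neg, abs_neg]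

theorem profFlux_neg (p : ℝ) : profFlux c κ η₀ (-p) = -profFlux c κ η₀ p := by
  simp only [profFlux, profEta_neg, abs_neg]
  split_ifs <;> ring

theorem profRate_nonneg (p : ℝ) : 0 ≤ profRate c κ η₀ p := by
  unfold profRate
  split_ifs <;> first | positivity | linarith

namespace Admissible

theorem lt_etaStar (ha : Admissible c κ η₀) : η₀ < etaStar κ := by
  nlinarith [ha.depth, min_le_left (etaStar κ) 0, sq_nonneg c]

theorem lt_neg (ha : Admissible c κ η₀) : η₀ < -2 - c ^ 2 := by
  linarith [ha.depth, min_le_right (etaStar κ) 0]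

theorem lt_zero (ha : Admissible c κ η₀) : η₀ < 0 := by
  linarith [ha.lt_neg, sq_nonneg c]

theorem crossing_pos (ha : Admissible c κ η₀) : 0 < crossing κ η₀ :=
  Real.sqrt_pos.2 (sub_pos.2 ha.lt_etaStar)

theorem crossing_sq (ha : Admissible c κ η₀) : crossing κ η₀ ^ 2 = etaStar κ - η₀ :=
  Real.sq_sqrt (sub_nonneg.2 ha.lt_etaStar.le)

theorem innerFactor_pos (ha : Admissible c κ η₀) {η : ℝ} (hη : η < 1) :
    0 < innerFactor c η₀ η := by
  have hlin : 0 < -2 * (η₀ + η) - c ^ 2 := by linarith [ha.lt_neg, sq_nonneg c]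
  have hconst : 0 ≤ c ^ 2 / (1 - η₀) := div_nonneg (sq_nonneg c) (by linarith [ha.lt_zero])
  unfold innerFactor
  linarith [mul_pos hlin (sub_pos.2 hη)]

theorem two_sub_sq_mul_etaStar_nonpos (ha : Admissible c κ η₀) :
    (2 - c ^ 2) * etaStar κ ≤ 0 := by
  have h : 2 * κ * ((2 - c ^ 2) * etaStar κ) ≤ 0 := by
    rw [mul_left_comm, two_mul_etaStar ha.pos]
    rcases lt_trichotomy κ (1 / 2) with hκ | hκ | hκ
    · exact mul_nonpos_of_nonneg_of_nonpos (by linarith [ha.sub hκ]) (by linarith)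
    · rw [hκ]; norm_num
    · exact mul_nonpos_of_nonpos_of_nonneg (by linarith [ha.super hκ]) (by linarith)
  exact nonpos_of_mul_nonpos_right h (by linarith [ha.pos])

theorem outerFactor_mul_le (ha : Admissible c κ η₀) (hr : 0 ≤ r) :
    etaStar κ * r * outerFactor c (etaStar κ * r) ≤ -2 * (etaStar κ * r) ^ 2 := by
  have := mul_nonpos_of_nonpos_of_nonneg ha.two_sub_sq_mul_etaStar_nonpos hr
  unfold outerFactor
  linarith

theorem outerFactor_mul_neg (ha : Admissible c κ η₀) (hκ : κ ≠ 1 / 2) (hr : 0 < r) :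
    etaStar κ * r * outerFactor c (etaStar κ * r) < 0 := by
  have : etaStar κ * r ≠ 0 := mul_ne_zero (etaStar_ne_zero ha.pos hκ) hr.ne'
  linarith [ha.outerFactor_mul_le hr.le, show 0 < (etaStar κ * r) ^ 2 by positivity]

theorem outerFactor_ne_zero (ha : Admissible c κ η₀) (hκ : κ ≠ 1 / 2) (hr : 0 < r) :
    outerFactor c (etaStar κ * r) ≠ 0 :=
  right_ne_zero_of_mul (ha.outerFactor_mul_neg hκ hr).ne

theorem diffusion_mul_outerFactor_pos (ha : Admissible c κ η₀) (hκ : κ ≠ 1 / 2) (hr : 0 < r)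
    (hr1 : r < 1) : 0 < diffusion κ (etaStar κ * r) * outerFactor c (etaStar κ * r) := by
  have h := mul_pos_of_neg_of_neg (etaStar_mul_mul_diffusion_neg ha.pos hκ hr hr1)
    (ha.outerFactor_mul_neg hκ hr)
  rw [mul_mul_mul_comm] at h
  exact (mul_pos_iff_of_pos_left
    (mul_self_pos.2 (mul_ne_zero (etaStar_ne_zero ha.pos hκ) hr.ne'))).1 h

theorem profEta_le_etaStar (ha : Admissible c κ η₀) (hp : |p| ≤ crossing κ η₀) :
    profEta κ η₀ p ≤ etaStar κ := by
  rw [profEta_of_le hp]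
  linarith [sq_le_sq.2 (hp.trans (le_abs_self _)), ha.crossing_sq]

theorem profEta_lt_etaStar (ha : Admissible c κ η₀) (hp : |p| < crossing κ η₀) :
    profEta κ η₀ p < etaStar κ := by
  rw [profEta_of_le hp.le]
  linarith [sq_lt_sq.2 (hp.trans_le (le_abs_self _)), ha.crossing_sq]

theorem profEta_of_eq (ha : Admissible c κ η₀) (hp : |p| = crossing κ η₀) :
    profEta κ η₀ p = etaStar κ := by
  rw [profEta_of_le hp.le, ← sq_abs, hp, ha.crossing_sq, add_sub_cancel]

theorem exists_profEta_eq_etaStar_mul (ha : Admissible c κ η₀) (hp : crossing κ η₀ ≤ |p|) :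
    ∃ r, 0 < r ∧ r ≤ 1 ∧ (crossing κ η₀ < |p| → r < 1) ∧ profEta κ η₀ p = etaStar κ * r := by
  refine ⟨Real.exp (crossing κ η₀ - |p|), Real.exp_pos _, Real.exp_le_one_iff.2 (by linarith),
    fun h => Real.exp_lt_one_iff.2 (by linarith), ?_⟩
  rcases hp.eq_or_lt with h | h
  · rw [ha.profEta_of_eq h.symm, h, sub_self, Real.exp_zero, mul_one]
  · exact profEta_of_lt h

theorem continuous_profEta (ha : Admissible c κ η₀) : Continuous (profEta κ η₀) := by
  unfold profEta
  refine Continuous.if_le (by fun_prop) (by fun_prop) continuous_abs continuous_const fun p hp => ?_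
  rw [hp, sub_self, Real.exp_zero, mul_one, ← sq_abs, hp, ha.crossing_sq, add_sub_cancel]

theorem le_profEta (ha : Admissible c κ η₀) (p : ℝ) : η₀ ≤ profEta κ η₀ p := by
  rcases le_total (|p|) (crossing κ η₀) with h | h
  · rw [profEta_of_le h]
    linarith [sq_nonneg p]
  · obtain ⟨r, hr, hr1, -, heq⟩ := ha.exists_profEta_eq_etaStar_mul h
    rw [heq]
    nlinarith [ha.lt_etaStar, ha.lt_zero]

theorem profEta_le (ha : Admissible c κ η₀) (p : ℝ) : profEta κ η₀ p ≤ max (etaStar κ) 0 := by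
  rcases le_total (|p|) (crossing κ η₀) with h | h
  · exact (ha.profEta_le_etaStar h).trans (le_max_left _ _)
  · obtain ⟨r, hr, hr1, -, heq⟩ := ha.exists_profEta_eq_etaStar_mul h
    rw [heq]
    rcases le_total (etaStar κ) 0 with h0 | h0
    · exact (mul_nonpos_of_nonpos_of_nonneg h0 hr.le).trans (le_max_right _ _)
    · exact (mul_le_of_le_one_right h0 hr1).trans (le_max_left _ _)

theorem max_etaStar_lt_one (ha : Admissible c κ η₀) : max (etaStar κ) 0 < 1 :=
  max_lt (etaStar_lt_one ha.pos) one_pos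

theorem profEta_lt_one (ha : Admissible c κ η₀) (p : ℝ) : profEta κ η₀ p < 1 :=
  (ha.profEta_le p).trans_lt ha.max_etaStar_lt_one

theorem profEta_half (ha : Admissible c (1 / 2) η₀) (hp : crossing (1 / 2) η₀ ≤ |p|) :
    profEta (1 / 2) η₀ p = 0 := by
  obtain ⟨r, -, -, -, heq⟩ := ha.exists_profEta_eq_etaStar_mul hp
  rw [heq, etaStar_half, zero_mul]

theorem diffusion_profEta_neg (ha : Admissible c κ η₀) (hp : |p| < crossing κ η₀) :
    diffusion κ (profEta κ η₀ p) < 0 := by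
  rw [diffusion_eq ha.pos]
  exact mul_neg_of_pos_of_neg (by linarith [ha.pos]) (sub_neg.2 (ha.profEta_lt_etaStar hp))

theorem diffusion_mul_outerFactor_profEta_pos (ha : Admissible c κ η₀) (hκ : κ ≠ 1 / 2)
    (hp : crossing κ η₀ < |p|) :
    0 < diffusion κ (profEta κ η₀ p) * outerFactor c (profEta κ η₀ p) := by
  obtain ⟨r, hr, -, hr1, heq⟩ := ha.exists_profEta_eq_etaStar_mul hp.le
  exact heq ▸ ha.diffusion_mul_outerFactor_pos hκ hr (hr1 hp)

theorem profEta_mul_diffusion_neg (ha : Admissible c κ η₀) (hκ : κ ≠ 1 / 2)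
    (hp : crossing κ η₀ < |p|) : profEta κ η₀ p * diffusion κ (profEta κ η₀ p) < 0 := by
  obtain ⟨r, hr, -, hr1, heq⟩ := ha.exists_profEta_eq_etaStar_mul hp.le
  exact heq ▸ etaStar_mul_mul_diffusion_neg ha.pos hκ hr (hr1 hp)

theorem diffusion_profEta_eq_zero_iff (ha : Admissible c κ η₀) (hκ : κ ≠ 1 / 2) (p : ℝ) :
    diffusion κ (profEta κ η₀ p) = 0 ↔ |p| = crossing κ η₀ := by
  refine ⟨fun h => ?_, fun h => by rw [ha.profEta_of_eq h, diffusion_etaStar ha.pos]⟩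
  rcases lt_trichotomy (|p|) (crossing κ η₀) with hp | hp | hp
  · exact absurd h (ha.diffusion_profEta_neg hp).ne
  · exact hp
  · exact absurd h (right_ne_zero_of_mul (ha.profEta_mul_diffusion_neg hκ hp).ne)

theorem eq_crossing_of_profRate_eq_zero (ha : Admissible c κ η₀) (h : profRate c κ η₀ p = 0) :
    |p| = crossing κ η₀ := by
  rcases lt_trichotomy (|p|) (crossing κ η₀) with hp | hp | hp
  · have := div_pos (neg_pos.2 (ha.diffusion_profEta_neg hp))
      (ha.innerFactor_pos (ha.profEta_lt_one p))
    rw [profRate, if_pos hp.le] at h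
    exact absurd h (by positivity)
  · exact hp
  · rw [profRate, if_neg hp.not_ge] at h
    split_ifs at h with hκ
    · linarith
    · have := div_pos_iff.2 (mul_pos_iff.1 (ha.diffusion_mul_outerFactor_profEta_pos hκ hp))
      exact absurd h (Real.sqrt_pos.2 this).ne'

theorem continuous_profRate (ha : Admissible c κ η₀) : Continuous (profRate c κ η₀) := by
  have hη := ha.continuous_profEta
  unfold profRate
  refine continuous_if_le continuous_abs continuous_const ?_ ?_ fun p hp => ?_
  · exact (Continuous.mul continuous_const (Real.continuous_sqrt.comp
      ((continuous_diffusion.comp hη).neg.div (continuous_innerFactor.comp hη) fun p =>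
        (ha.innerFactor_pos (ha.profEta_lt_one p)).ne'))).continuousOn
  · split_ifs with hκ
    · fun_prop
    · refine ContinuousOn.sqrt (ContinuousOn.div (by fun_prop) (by fun_prop) fun p hp => ?_)
      obtain ⟨r, hr, -, -, heq⟩ := ha.exists_profEta_eq_etaStar_mul hp
      exact heq ▸ ha.outerFactor_ne_zero hκ hr
  · simp [ha.profEta_of_eq hp, diffusion_etaStar ha.pos, hp]

theorem continuous_profFlux (ha : Admissible c κ η₀) : Continuous (profFlux c κ η₀) := by
  have hη := ha.continuous_profEta
  unfold profFlux
  refine continuous_if_le continuous_abs continuous_const (by fun_prop) ?_ fun p hp => ?_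
  · have hdiv : ContinuousOn (fun p : ℝ => p / |p|) {p | crossing κ η₀ ≤ |p|} :=
      continuousOn_id.div continuous_abs.continuousOn fun p hp => (ha.crossing_pos.trans_le hp).ne'
    exact (hdiv.mul (by fun_prop)).mul (by fun_prop)
  · simp [ha.profEta_of_eq hp, diffusion_etaStar ha.pos]

theorem le_diffusion_div_outerFactor (ha : Admissible c κ η₀) (hκ : κ ≠ 1 / 2) {s : ℝ}
    (hr : 0 < r) (hrs : r ≤ s) (hs : s < 1) :
    |1 - 2 * κ| * (1 - s) / (|2 - c ^ 2| + 2 * |etaStar κ|) ≤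
      diffusion κ (etaStar κ * r) / outerFactor c (etaStar κ * r) := by
  have hr1 : r < 1 := hrs.trans_lt hs
  have hO : |outerFactor c (etaStar κ * r)| ≤ |2 - c ^ 2| + 2 * |etaStar κ| := by
    refine (abs_sub _ _).trans (add_le_add_right ?_ _)
    rw [abs_mul, abs_two, abs_mul, abs_of_pos hr]
    nlinarith [abs_nonneg (etaStar κ)]
  have hquot := div_pos_iff.2 (mul_pos_iff.1 (ha.diffusion_mul_outerFactor_pos hκ hr hr1))
  rw [← abs_of_pos hquot, abs_div, diffusion_etaStar_mul ha.pos, abs_mul,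
    abs_of_pos (sub_pos.2 hr1)]
  exact div_le_div₀ (mul_nonneg (abs_nonneg _) (by linarith))
    (mul_le_mul_of_nonneg_left (by linarith) (abs_nonneg _))
    (abs_pos.2 (ha.outerFactor_ne_zero hκ hr)) hO

theorem exists_pos_le_profRate (ha : Admissible c κ η₀) :
    ∃ δ > 0, ∀ p, crossing κ η₀ + 1 ≤ p → δ ≤ profRate c κ η₀ p := by
  have habs : ∀ p, crossing κ η₀ + 1 ≤ p → crossing κ η₀ + 1 ≤ |p| := fun p hp =>
    hp.trans (le_abs_self p)
  by_cases hκ : κ = 1 / 2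
  · refine ⟨1, one_pos, fun p hp => ?_⟩
    have := habs p hp
    rw [profRate, if_neg (by linarith), if_pos hκ]
    linarith
  · have he : Real.exp (-1) < 1 := Real.exp_lt_one_iff.2 (by norm_num)
    have hκ' : 0 < |1 - 2 * κ| := abs_pos.2 fun h => hκ (by linarith)
    have hη : 0 < |etaStar κ| := abs_pos.2 (etaStar_ne_zero ha.pos hκ)
    have : 0 < 1 - Real.exp (-1) := sub_pos.2 he
    refine ⟨√(|1 - 2 * κ| * (1 - Real.exp (-1)) / (|2 - c ^ 2| + 2 * |etaStar κ|)),
      Real.sqrt_pos.2 (by positivity), fun p hp => ?_⟩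
    have hp' := habs p hp
    rw [profRate, if_neg (by linarith), if_neg hκ, profEta_of_lt (by linarith)]
    exact Real.sqrt_le_sqrt (ha.le_diffusion_div_outerFactor hκ (Real.exp_pos _)
      (Real.exp_le_exp.2 (by linarith)) he)

end Admissible

end Profile

section FirstIntegral

variable {c κ K σ d x : ℝ} {η : ℝ → ℝ}

theorem hasDerivAt_potential (c K η : ℝ) :
    HasDerivAt (potential c K) (2 * η * outerFactor c η - 2 * η ^ 2 - K) η := by
  have hO : HasDerivAt (outerFactor c) (-2) η :=
    (((hasDerivAt_id η).const_mul 2).const_sub (2 - c ^ 2)).congr_deriv (by ring)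
  refine (((hasDerivAt_pow 2 η).mul hO).add
    (((hasDerivAt_id η).const_sub 1).const_mul K)).congr_deriv ?_
  simp only [Nat.cast_ofNat, Nat.add_one_sub_one, pow_one]
  ring

theorem hasDerivAt_diffusion (κ η : ℝ) : HasDerivAt (diffusion κ) (2 * κ) η :=
  (((hasDerivAt_id η).const_mul (2 * κ)).const_add (1 - 2 * κ)).congr_deriv (mul_one _)

theorem hasDerivAt_flux_of_firstIntegral (hη : HasDerivAt η d x) (h1 : η x ≠ 1)
    (hpos : 0 < diffusion κ (η x) * potential c K (η x)) (hσ : σ ^ 2 = 1)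
    (hflux : σ * √(diffusion κ (η x) * potential c K (η x)) = diffusion κ (η x) * d) :
    HasDerivAt (fun y => σ * √(diffusion κ (η y) * potential c K (η y)))
      (fluxDeriv c κ (η x) d) x := by
  have hder := ((((hasDerivAt_diffusion κ (η x)).comp x hη).mul
    ((hasDerivAt_potential c K (η x)).comp x hη)).sqrt hpos.ne').const_mul σ
  refine hder.congr_deriv ?_
  have hs := Real.sqrt_pos.2 hpos
  have hsq := Real.sq_sqrt hpos.le
  simp only [Pi.mul_apply, Function.comp_apply]
  set D := diffusion κ (η x) with hD
  set V := potential c K (η x) with hV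
  set s := √(D * V)
  have hD0 : D ≠ 0 := left_ne_zero_of_mul hpos.ne'
  have hVd : V = D * d ^ 2 := by
    apply mul_left_cancel₀ hD0
    linear_combination -hsq - s ^ 2 * hσ + (σ * s + D * d) * hflux
  have hσs : σ * (2 * κ * d * V + D * ((2 * η x * outerFactor c (η x) - 2 * η x ^ 2 - K) * d)) =
      2 * s * (κ * d ^ 2 + (2 * η x * outerFactor c (η x) - 2 * η x ^ 2 - K) / 2) := by
    rw [hVd]
    linear_combination (2 * s * (κ * d ^ 2 +
      (2 * η x * outerFactor c (η x) - 2 * η x ^ 2 - K) / 2)) * hσ - (2 * σ * (κ * d ^ 2 +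
      (2 * η x * outerFactor c (η x) - 2 * η x ^ 2 - K) / 2)) * hflux
  rw [← mul_div_assoc, div_eq_iff (by positivity), hσs, mul_comm]
  congr 1
  have h1' : 1 - η x ≠ 0 := sub_ne_zero.2 h1.symm
  rw [hV, hD, potential, diffusion] at hVd
  unfold fluxDeriv
  field_simp
  unfold outerFactor at *
  linear_combination -hVd

end FirstIntegral

theorem sqrt_mul_mul_sqrt_div {a b : ℝ} (h : 0 < a * b) : √(a * b) * √(a / b) = |a| := by
  have hb : b ≠ 0 := right_ne_zero_of_mul h.ne'
  rw [← Real.sqrt_mul h.le, ← Real.sqrt_sq_eq_abs]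
  congr 1
  field_simp

theorem div_abs_sq {p : ℝ} (hp : p ≠ 0) : (p / |p|) ^ 2 = 1 := by
  rw [div_pow, sq_abs, div_self (pow_ne_zero 2 hp)]

theorem eventually_div_abs_eq {p : ℝ} (hp : p ≠ 0) : ∀ᶠ t in 𝓝 p, t / |t| = p / |p| := by
  rcases hp.lt_or_gt with h | h
  · filter_upwards [gt_mem_nhds h] with t ht
    rw [abs_of_neg h, abs_of_neg ht, div_neg_self h.ne, div_neg_self ht.ne]
  · filter_upwards [lt_mem_nhds h] with t ht
    rw [abs_of_pos h, abs_of_pos ht, div_self h.ne', div_self ht.ne']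

section Profile

variable {c κ η₀ p : ℝ}

theorem profFlux_of_gt (hp : crossing κ η₀ < |p|) :
    profFlux c κ η₀ p = p / |p| *
      √(diffusion κ (profEta κ η₀ p) * potential c 0 (profEta κ η₀ p)) := by
  rw [potential_zero_level, profFlux, if_neg hp.not_ge, mul_left_comm,
    Real.sqrt_mul (sq_nonneg _), Real.sqrt_sq_eq_abs, mul_assoc]

theorem diffusion_mul_profSlope (c κ η₀ p : ℝ) :
    diffusion κ (profEta κ η₀ p) * profSlope c κ η₀ p = profFlux c κ η₀ p := by
  refine mul_div_cancel_of_imp' fun h => ?_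
  rcases le_or_gt (|p|) (crossing κ η₀) with hp | hp
  · simp [profFlux, hp, h]
  · simp [profFlux, hp.not_ge, h]

theorem hasDerivAt_profEta_of_lt (hp : |p| < crossing κ η₀) :
    HasDerivAt (profEta κ η₀) (2 * p) p := by
  refine (((hasDerivAt_pow 2 p).const_add η₀).congr_deriv (by simp)).congr_of_eventuallyEq ?_
  filter_upwards [continuous_abs.continuousAt.eventually_lt_const hp] with t ht
  exact profEta_of_le ht.le

theorem hasDerivAt_profEta_of_gt (hp0 : p ≠ 0) (hp : crossing κ η₀ < |p|) :
    HasDerivAt (profEta κ η₀) (-(p / |p|) * profEta κ η₀ p) p := by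
  rw [profEta_of_lt hp]
  have hder := (((hasDerivAt_abs hp0).const_sub (crossing κ η₀)).exp).const_mul (etaStar κ)
  have hsign : (SignType.sign p : ℝ) = p / |p| := by
    rw [eq_div_iff (abs_ne_zero.2 hp0), sign_mul_abs]
  refine (hder.congr_deriv (by rw [hsign]; ring)).congr_of_eventuallyEq ?_
  filter_upwards [continuous_abs.continuousAt.eventually_const_lt hp] with t ht
  exact profEta_of_lt ht

end Profile

namespace Admissible

variable {c κ η₀ p : ℝ}

theorem potential_innerLevel_profEta (ha : Admissible c κ η₀) (hp : |p| ≤ crossing κ η₀) :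
    potential c (innerLevel c η₀) (profEta κ η₀ p) =
      -p ^ 2 * innerFactor c η₀ (profEta κ η₀ p) := by
  rw [potential_innerLevel (by linarith [ha.lt_zero]), profEta_of_le hp]
  ring

theorem neg_diffusion_mul_innerFactor_profEta_pos (ha : Admissible c κ η₀)
    (hp : |p| < crossing κ η₀) :
    0 < -diffusion κ (profEta κ η₀ p) * innerFactor c η₀ (profEta κ η₀ p) :=
  mul_pos (neg_pos.2 (ha.diffusion_profEta_neg hp)) (ha.innerFactor_pos (ha.profEta_lt_one p))

theorem profFlux_of_lt (ha : Admissible c κ η₀) (hp0 : p ≠ 0) (hp : |p| < crossing κ η₀) :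
    profFlux c κ η₀ p = -(p / |p|) *
      √(diffusion κ (profEta κ η₀ p) * potential c (innerLevel c η₀) (profEta κ η₀ p)) := by
  have habs : |p| ≠ 0 := abs_ne_zero.2 hp0
  rw [ha.potential_innerLevel_profEta hp.le, profFlux, if_pos hp.le,
    show ∀ D I : ℝ, D * (-p ^ 2 * I) = p ^ 2 * (-D * I) from fun _ _ => by ring,
    Real.sqrt_mul (sq_nonneg p), Real.sqrt_sq_eq_abs]
  field_simp

theorem exists_eventually_profFlux_eq (ha : Admissible c κ η₀) (hp0 : p ≠ 0)
    (hD : diffusion κ (profEta κ η₀ p) ≠ 0) :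
    ∃ K σ : ℝ, σ ^ 2 = 1 ∧ 0 < diffusion κ (profEta κ η₀ p) * potential c K (profEta κ η₀ p) ∧
      ∀ᶠ t in 𝓝 p, profFlux c κ η₀ t =
        σ * √(diffusion κ (profEta κ η₀ t) * potential c K (profEta κ η₀ t)) := by
  rcases lt_trichotomy (|p|) (crossing κ η₀) with hp | hp | hp
  · refine ⟨innerLevel c η₀, -(p / |p|), by rw [neg_sq, div_abs_sq hp0], ?_, ?_⟩
    · rw [ha.potential_innerLevel_profEta hp.le]
      have := mul_pos (sq_pos_of_ne_zero hp0) (ha.neg_diffusion_mul_innerFactor_profEta_pos hp)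
      linarith
    · filter_upwards [eventually_div_abs_eq hp0, continuous_abs.continuousAt.eventually_lt_const hp,
        eventually_ne_nhds hp0] with t ht htT ht0
      rw [← ht, ha.profFlux_of_lt ht0 htT]
  · exact absurd (by rw [ha.profEta_of_eq hp, diffusion_etaStar ha.pos]) hD
  · have hκ : κ ≠ 1 / 2 := by
      rintro rfl
      exact hD (by rw [ha.profEta_half hp.le]; norm_num [diffusion])
    refine ⟨0, p / |p|, div_abs_sq hp0, ?_, ?_⟩
    · have hη := left_ne_zero_of_mul (ha.profEta_mul_diffusion_neg hκ hp).ne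
      rw [potential_zero_level, mul_left_comm]
      exact mul_pos (sq_pos_of_ne_zero hη) (ha.diffusion_mul_outerFactor_profEta_pos hκ hp)
    · filter_upwards [eventually_div_abs_eq hp0,
        continuous_abs.continuousAt.eventually_const_lt hp] with t ht htT
      rw [← ht, profFlux_of_gt htT]

theorem profSlope_ne_zero (ha : Admissible c κ η₀) (hp0 : p ≠ 0)
    (hD : diffusion κ (profEta κ η₀ p) ≠ 0) : profSlope c κ η₀ p ≠ 0 := by
  obtain ⟨K, σ, hσ, hpos, hflux⟩ := ha.exists_eventually_profFlux_eq (c := c) hp0 hD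
  rw [profSlope, hflux.self_of_nhds]
  exact div_ne_zero (mul_ne_zero (fun h => by simp [h] at hσ) (Real.sqrt_pos.2 hpos).ne') hD

theorem profFlux_half (ha : Admissible c (1 / 2) η₀) (hp : crossing (1 / 2) η₀ ≤ |p|) :
    profFlux c (1 / 2) η₀ p = 0 := by
  have hη := ha.profEta_half hp
  rw [profFlux, hη, abs_zero, mul_zero, zero_mul]
  norm_num [diffusion]

theorem profSlope_mul_profRate_of_lt (ha : Admissible c κ η₀) (hp : |p| < crossing κ η₀) :
    profSlope c κ η₀ p * profRate c κ η₀ p = 2 * p := by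
  have hD := ha.diffusion_profEta_neg hp
  have h := sqrt_mul_mul_sqrt_div (ha.neg_diffusion_mul_innerFactor_profEta_pos hp)
  rw [abs_neg, abs_of_neg hD] at h
  rw [profSlope, profFlux, profRate, if_pos hp.le, if_pos hp.le, div_mul_eq_mul_div,
    div_eq_iff hD.ne]
  linear_combination -2 * p * h

theorem profSlope_mul_profRate_of_gt (ha : Admissible c κ η₀) (hκ : κ ≠ 1 / 2)
    (hp : crossing κ η₀ < |p|) :
    profSlope c κ η₀ p * profRate c κ η₀ p = -(p / |p|) * profEta κ η₀ p := by
  have hneg := ha.profEta_mul_diffusion_neg hκ hp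
  have h := sqrt_mul_mul_sqrt_div (ha.diffusion_mul_outerFactor_profEta_pos hκ hp)
  have habs := abs_of_neg hneg
  rw [abs_mul, ← h] at habs
  rw [profSlope, profFlux, profRate, if_neg hp.not_ge, if_neg hp.not_ge, if_neg hκ,
    div_mul_eq_mul_div, div_eq_iff (right_ne_zero_of_mul hneg.ne)]
  linear_combination (p / |p|) * habs

theorem hasDerivAt_profEta (ha : Admissible c κ η₀) (hp : |p| ≠ crossing κ η₀) :
    HasDerivAt (profEta κ η₀) (profSlope c κ η₀ p * profRate c κ η₀ p) p := by
  rcases hp.lt_or_gt with hp | hp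
  · rw [ha.profSlope_mul_profRate_of_lt hp]
    exact hasDerivAt_profEta_of_lt hp
  · have hder := hasDerivAt_profEta_of_gt (abs_pos.1 (ha.crossing_pos.trans hp)) hp
    by_cases hκ : κ = 1 / 2
    · subst hκ
      rwa [profSlope, ha.profFlux_half hp.le, zero_div, zero_mul, ← mul_zero (-(p / |p|)),
        ← ha.profEta_half hp.le]
    · rwa [ha.profSlope_mul_profRate_of_gt hκ hp]

end Admissible

/-- `P` is the inverse of the clock of the profile, that is, the desingularized parameter as a
function of position. -/
structure ProfileClock (c κ η₀ : ℝ) (P : ℝ → ℝ) : Prop where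
  cont : Continuous P
  mono : StrictMono P
  clock_apply : ∀ x, clock (profRate c κ η₀) (P x) = x
  apply_clock : ∀ p, P (clock (profRate c κ η₀) p) = p
  odd : ∀ x, P (-x) = -P x
  deriv : ∀ x, profRate c κ η₀ (P x) ≠ 0 → HasDerivAt P (profRate c κ η₀ (P x))⁻¹ x

/-- The position at which the profile reaches the singular value. -/
noncomputable def crossingPoint (c κ η₀ : ℝ) : ℝ := clock (profRate c κ η₀) (crossing κ η₀)

theorem Admissible.exists_profileClock {c κ η₀ : ℝ} (ha : Admissible c κ η₀) :
    ∃ P, ProfileClock c κ η₀ P := by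
  obtain ⟨δ, hδ, hle⟩ := ha.exists_pos_le_profRate
  obtain ⟨P, hcont, hmono, hclock, happly, hodd, hderiv⟩ :=
    exists_inverse_clock ha.continuous_profRate profRate_neg profRate_nonneg
      (fun _ => ha.eq_crossing_of_profRate_eq_zero)
      (tendsto_clock_atTop ha.continuous_profRate hδ hle)
  exact ⟨P, hcont, hmono, hclock, happly, hodd, hderiv⟩

namespace ProfileClock

variable {c κ η₀ x : ℝ} {P : ℝ → ℝ}

theorem zero (hP : ProfileClock c κ η₀ P) : P 0 = 0 := by
  simpa only [clock_zero] using hP.apply_clock 0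

theorem apply_crossingPoint (hP : ProfileClock c κ η₀ P) :
    P (crossingPoint c κ η₀) = crossing κ η₀ := hP.apply_clock _

theorem crossingPoint_pos (hP : ProfileClock c κ η₀ P) (ha : Admissible c κ η₀) :
    0 < crossingPoint c κ η₀ := by
  rw [← hP.mono.lt_iff_lt, hP.zero, hP.apply_crossingPoint]
  exact ha.crossing_pos

theorem apply_ne_zero (hP : ProfileClock c κ η₀ P) (hx : x ≠ 0) : P x ≠ 0 :=
  hP.zero ▸ hP.mono.injective.ne hx

theorem abs_apply (hP : ProfileClock c κ η₀ P) (x : ℝ) : |P x| = P |x| := by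
  have hmono := hP.mono.monotone
  rcases le_total 0 x with h | h
  · rw [abs_of_nonneg h, abs_of_nonneg (hP.zero ▸ hmono h)]
  · rw [abs_of_nonpos h, abs_of_nonpos (hP.zero ▸ hmono h), hP.odd]

theorem abs_lt_iff (hP : ProfileClock c κ η₀ P) (x : ℝ) :
    |P x| < crossing κ η₀ ↔ |x| < crossingPoint c κ η₀ := by
  rw [hP.abs_apply, ← hP.apply_crossingPoint, hP.mono.lt_iff_lt]

theorem lt_abs_iff (hP : ProfileClock c κ η₀ P) (x : ℝ) :
    crossing κ η₀ < |P x| ↔ crossingPoint c κ η₀ < |x| := by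
  rw [hP.abs_apply, ← hP.apply_crossingPoint, hP.mono.lt_iff_lt]

theorem abs_eq_iff (hP : ProfileClock c κ η₀ P) (x : ℝ) :
    |P x| = crossing κ η₀ ↔ |x| = crossingPoint c κ η₀ := by
  rw [hP.abs_apply, ← hP.apply_crossingPoint, hP.mono.injective.eq_iff]

theorem hasDerivAt (hP : ProfileClock c κ η₀ P) (ha : Admissible c κ η₀)
    (hx : |x| ≠ crossingPoint c κ η₀) : HasDerivAt P (profRate c κ η₀ (P x))⁻¹ x :=
  hP.deriv x fun h => hx ((hP.abs_eq_iff x).1 (ha.eq_crossing_of_profRate_eq_zero h))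

theorem hasDerivAt_eta (hP : ProfileClock c κ η₀ P) (ha : Admissible c κ η₀)
    (hx : |x| ≠ crossingPoint c κ η₀) :
    HasDerivAt (fun y => profEta κ η₀ (P y)) (profSlope c κ η₀ (P x)) x := by
  have hPx : |P x| ≠ crossing κ η₀ := mt (hP.abs_eq_iff x).1 hx
  refine ((ha.hasDerivAt_profEta hPx).comp x (hP.hasDerivAt ha hx)).congr_deriv ?_
  exact mul_inv_cancel_right₀ (fun h => hPx (ha.eq_crossing_of_profRate_eq_zero h)) _

theorem hasDerivAt_flux (hP : ProfileClock c κ η₀ P) (ha : Admissible c κ η₀) (hx0 : x ≠ 0)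
    (hx : |x| ≠ crossingPoint c κ η₀) :
    HasDerivAt (fun y => profFlux c κ η₀ (P y))
      (fluxDeriv c κ (profEta κ η₀ (P x)) (profSlope c κ η₀ (P x))) x := by
  by_cases hD : diffusion κ (profEta κ η₀ (P x)) = 0
  · obtain rfl : κ = 1 / 2 := by
      by_contra hκ
      exact hx ((hP.abs_eq_iff x).1 ((ha.diffusion_profEta_eq_zero_iff hκ _).1 hD))
    have hout : crossing (1 / 2) η₀ < |P x| := by
      refine lt_of_le_of_ne (not_lt.1 fun h => ?_) (Ne.symm (mt (hP.abs_eq_iff x).1 hx))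
      exact (ha.diffusion_profEta_neg h).ne hD
    have hzero : fluxDeriv c (1 / 2) (profEta (1 / 2) η₀ (P x)) (profSlope c (1 / 2) η₀ (P x)) =
        0 := by
      rw [profSlope, ha.profFlux_half hout.le, ha.profEta_half hout.le]
      simp [fluxDeriv]
    rw [hzero]
    refine (hasDerivAt_const x 0).congr_of_eventuallyEq ?_
    filter_upwards [(continuous_abs.comp hP.cont).continuousAt.eventually_const_lt hout] with y hy
    exact ha.profFlux_half hy.le
  · obtain ⟨K, σ, hσ, hpos, hflux⟩ :=
      ha.exists_eventually_profFlux_eq (c := c) (hP.apply_ne_zero hx0) hD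
    have hder := hasDerivAt_flux_of_firstIntegral (hP.hasDerivAt_eta ha hx)
      (ha.profEta_lt_one _).ne hpos hσ
      (by rw [← hflux.self_of_nhds, diffusion_mul_profSlope])
    exact hder.congr_of_eventuallyEq (hP.cont.continuousAt.eventually hflux)

theorem continuous_eta (hP : ProfileClock c κ η₀ P) (ha : Admissible c κ η₀) :
    Continuous (fun y => profEta κ η₀ (P y)) := ha.continuous_profEta.comp hP.cont

theorem continuous_flux (hP : ProfileClock c κ η₀ P) (ha : Admissible c κ η₀) :
    Continuous (fun y => profFlux c κ η₀ (P y)) := ha.continuous_profFlux.comp hP.cont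

theorem measurable_slope (hP : ProfileClock c κ η₀ P) (ha : Admissible c κ η₀) :
    Measurable (fun y => profSlope c κ η₀ (P y)) :=
  (hP.continuous_flux ha).measurable.div
    (continuous_diffusion.comp (hP.continuous_eta ha)).measurable

theorem tendsto_atTop (hP : ProfileClock c κ η₀ P) : Tendsto P atTop atTop :=
  hP.mono.monotone.tendsto_atTop_atTop fun p => ⟨_, (hP.apply_clock p).ge⟩

theorem tendsto_eta (hP : ProfileClock c κ η₀ P) :
    Tendsto (fun y => profEta κ η₀ (P y)) atTop (𝓝 0) := by
  have hexp : Tendsto (fun p => etaStar κ * Real.exp (crossing κ η₀ - p)) atTop (𝓝 0) := by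
    simpa [sub_eq_add_neg] using (Real.tendsto_exp_atBot.comp
      (tendsto_atBot_add_const_left _ (crossing κ η₀) tendsto_neg_atTop_atBot)).const_mul
        (etaStar κ)
  refine Tendsto.comp (g := profEta κ η₀) (hexp.congr' ?_) hP.tendsto_atTop
  filter_upwards [eventually_gt_atTop (crossing κ η₀), eventually_ge_atTop 0] with p hp hp0
  rw [← abs_of_nonneg hp0] at hp
  rw [profEta_of_lt hp, abs_of_nonneg hp0]

theorem tendsto_flux (hP : ProfileClock c κ η₀ P) :
    Tendsto (fun y => profFlux c κ η₀ (P y)) atTop (𝓝 0) := by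
  have hcont : Continuous fun η => √(diffusion κ η * potential c 0 η) := by
    simp only [potential_zero_level]
    fun_prop
  have hlim := (hcont.tendsto 0).comp hP.tendsto_eta
  rw [potential_zero_level, zero_pow two_ne_zero, zero_mul, mul_zero, Real.sqrt_zero] at hlim
  refine hlim.congr' ?_
  filter_upwards [hP.tendsto_atTop.eventually_gt_atTop (crossing κ η₀),
    hP.tendsto_atTop.eventually_gt_atTop 0] with y hy hy0
  rw [profFlux_of_gt (hy.trans_le (le_abs_self _)), abs_of_pos hy0, div_self hy0.ne', one_mul,
    Function.comp_apply]

end ProfileClock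

theorem integrable_of_even_of_integrableOn_Ioi {f : ℝ → ℝ} (he : ∀ x, f (-x) = f x)
    (h : IntegrableOn f (Ioi 0)) : Integrable f := by
  have hneg : IntegrableOn f (Iio 0) := by
    rw [← (Measure.measurePreserving_neg (volume : Measure ℝ)).integrableOn_comp_preimage
      (Homeomorph.neg ℝ).measurableEmbedding, show f ∘ Neg.neg = f from funext he]
    simpa using h
  rw [← integrableOn_univ, ← Iic_union_Ioi (a := (0 : ℝ))]
  exact ((integrableOn_Iic_iff_integrableOn_Iio (by simp)).2 hneg).union h

/-- The part of `fluxDeriv` that remains after subtracting the quadratic term in `η'`, divided by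
`η (1 - η)`. -/
noncomputable def fluxRemainder (c η : ℝ) : ℝ := 2 - c ^ 2 / (1 - η) - c ^ 2 * η / (2 * (1 - η) ^ 2)

theorem continuousOn_fluxRemainder (c : ℝ) : ContinuousOn (fluxRemainder c) (Iio 1) := by
  have h1 : ∀ η ∈ Iio (1 : ℝ), 1 - η ≠ 0 := fun η hη => (sub_pos.2 hη).ne'
  unfold fluxRemainder
  exact (continuousOn_const.sub (continuousOn_const.div (by fun_prop) h1)).sub
    (ContinuousOn.div (by fun_prop) (by fun_prop) fun η hη => by have := h1 η hη; positivity)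

theorem hasDerivAt_flux_div {c κ d x : ℝ} {η q : ℝ → ℝ} (hη : HasDerivAt η d x)
    (hq : HasDerivAt q (fluxDeriv c κ (η x) d) x) (hD : q x = diffusion κ (η x) * d)
    (h1 : η x < 1) :
    HasDerivAt (fun y => q y / (1 - η y))
      (d ^ 2 / (2 * (1 - η x) ^ 2) + η x * fluxRemainder c (η x)) x := by
  have h1' : 1 - η x ≠ 0 := (sub_pos.2 h1).ne'
  refine (hq.div (hη.const_sub 1) h1').congr_deriv ?_
  rw [hD]
  unfold fluxDeriv diffusion fluxRemainder
  field_simp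
  ring

namespace Admissible

variable {c κ η₀ p : ℝ}

theorem profRate_sq_mul_abs_profEta_le (ha : Admissible c κ η₀) (hκ : κ ≠ 1 / 2)
    (hp : crossing κ η₀ < |p|) :
    profRate c κ η₀ p ^ 2 * (2 * |profEta κ η₀ p|) ≤ |1 - 2 * κ| := by
  have hpos := ha.diffusion_mul_outerFactor_profEta_pos hκ hp
  rw [profRate, if_neg hp.not_ge, if_neg hκ, Real.sq_sqrt (div_pos_iff.2 (mul_pos_iff.1 hpos)).le]
  obtain ⟨r, hr, hr1, -, heq⟩ := ha.exists_profEta_eq_etaStar_mul hp.le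
  rw [heq] at hpos ⊢
  have hO : 2 * |etaStar κ * r| ≤ |outerFactor c (etaStar κ * r)| := by
    have hη : 0 < |etaStar κ * r| := abs_pos.2 (mul_ne_zero (etaStar_ne_zero ha.pos hκ) hr.ne')
    have hle := ha.outerFactor_mul_le hr.le
    have habs := neg_le_abs (etaStar κ * r * outerFactor c (etaStar κ * r))
    rw [abs_mul] at habs
    refine le_of_mul_le_mul_left ?_ hη
    nlinarith [sq_abs (etaStar κ * r)]
  have hO0 : 0 < |outerFactor c (etaStar κ * r)| := abs_pos.2 (right_ne_zero_of_mul hpos.ne')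
  rw [← abs_of_pos (div_pos_iff.2 (mul_pos_iff.1 hpos)), abs_div, div_mul_eq_mul_div,
    div_le_iff₀ hO0, diffusion_etaStar_mul ha.pos, abs_mul, abs_of_nonneg (sub_nonneg.2 hr1)]
  exact mul_le_mul (mul_le_of_le_one_right (abs_nonneg _) (by linarith)) hO (by positivity)
    (abs_nonneg _)

theorem exists_abs_fluxRemainder_le (ha : Admissible c κ η₀) :
    ∃ C, ∀ p, |fluxRemainder c (profEta κ η₀ p)| ≤ C := by
  obtain ⟨C, hC⟩ := isCompact_Icc.exists_bound_of_continuousOn (continuousOn_fluxRemainder c |>.mono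
    fun η (hη : η ∈ Icc η₀ (max (etaStar κ) 0)) => hη.2.trans_lt ha.max_etaStar_lt_one)
  exact ⟨C, fun p => hC _ ⟨ha.le_profEta p, ha.profEta_le p⟩⟩

end Admissible

namespace ProfileClock

variable {c κ η₀ : ℝ} {P : ℝ → ℝ}

theorem even_eta (hP : ProfileClock c κ η₀ P) (x : ℝ) :
    profEta κ η₀ (P (-x)) = profEta κ η₀ (P x) := by rw [hP.odd, profEta_neg]

theorem odd_slope (hP : ProfileClock c κ η₀ P) (x : ℝ) :
    profSlope c κ η₀ (P (-x)) = -profSlope c κ η₀ (P x) := by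
  rw [hP.odd, profSlope, profFlux_neg, profEta_neg, neg_div, profSlope]

theorem lt_abs_of_crossingPoint_lt (hP : ProfileClock c κ η₀ P) {x : ℝ}
    (hx : crossingPoint c κ η₀ < x) : crossing κ η₀ < |P x| :=
  (hP.lt_abs_iff x).2 (hx.trans_le (le_abs_self x))

/-- In the outer region `|η|` is a multiple of `Φ²` for `Φ = exp (-P / 2)`, and it is dominated by
a multiple of `-Φ'`. -/
theorem integrableOn_eta_outer (hP : ProfileClock c κ η₀ P) (ha : Admissible c κ η₀)
    (hκ : κ ≠ 1 / 2) :
    IntegrableOn (fun y => profEta κ η₀ (P y)) (Ioi (crossingPoint c κ η₀)) := by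
  set R := crossingPoint c κ η₀
  have hR : ∀ x ∈ Ioi R, |x| ≠ R := fun x hx => (lt_of_lt_of_le hx (le_abs_self x)).ne'
  let Φ : ℝ → ℝ := fun y => Real.exp ((crossing κ η₀ - P y) / 2)
  have hΦ : ∀ x ∈ Ioi R, HasDerivAt Φ (Φ x * (-(profRate c κ η₀ (P x))⁻¹ / 2)) x := fun x hx =>
    (((hP.hasDerivAt ha (hR x hx)).const_sub _).div_const 2).exp
  have hΦlim : Tendsto Φ atTop (𝓝 0) := Real.tendsto_exp_atBot.comp
    ((tendsto_atBot_add_const_left _ _ (tendsto_neg_atBot_iff.2 hP.tendsto_atTop)).atBot_div_const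
      two_pos)
  have hint : IntegrableOn (fun x => Φ x * (-(profRate c κ η₀ (P x))⁻¹ / 2)) (Ioi R) := by
    refine integrableOn_Ioi_deriv_of_nonpos ?_ hΦ (fun x _ => ?_) hΦlim
    · exact Continuous.continuousWithinAt (by have := hP.cont; fun_prop)
    · have := inv_nonneg.2 (profRate_nonneg (c := c) (κ := κ) (η₀ := η₀) (P x))
      exact mul_nonpos_of_nonneg_of_nonpos (Real.exp_pos _).le (by linarith)
  refine (hint.norm.const_mul √(2 * |etaStar κ| * |1 - 2 * κ|)).mono'
    (hP.continuous_eta ha).aestronglyMeasurable ?_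
  filter_upwards [ae_restrict_mem measurableSet_Ioi] with x hx
  have hout := hP.lt_abs_of_crossingPoint_lt hx
  have hPx : 0 < P x := hP.zero ▸ hP.mono ((hP.crossingPoint_pos ha).trans hx)
  have hρ : 0 < profRate c κ η₀ (P x) := (profRate_nonneg _).lt_of_ne' fun h =>
    hout.ne' (ha.eq_crossing_of_profRate_eq_zero h)
  have hη : |profEta κ η₀ (P x)| = |etaStar κ| * Φ x ^ 2 := by
    rw [profEta_of_lt hout, abs_mul, Real.abs_exp, abs_of_pos hPx, ← Real.exp_nat_mul]
    congr 2
    push_cast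
    ring
  have hrate := ha.profRate_sq_mul_abs_profEta_le (c := c) hκ hout
  have hΦx : 0 < Φ x := Real.exp_pos _
  have hmain : 2 * |etaStar κ| * Φ x * profRate c κ η₀ (P x) ≤
      √(2 * |etaStar κ| * |1 - 2 * κ|) := by
    refine Real.le_sqrt_of_sq_le ?_
    rw [hη] at hrate
    linear_combination (2 * |etaStar κ|) * hrate
  rw [Real.norm_eq_abs, Real.norm_eq_abs, hη, abs_mul, abs_div, abs_neg, abs_inv,
    abs_of_pos hΦx, abs_of_pos hρ, abs_two]
  rw [← le_div_iff₀ hρ] at hmain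
  calc |etaStar κ| * Φ x ^ 2 = 2 * |etaStar κ| * Φ x * (Φ x / 2) := by ring
    _ ≤ _ := mul_le_mul_of_nonneg_right hmain (by positivity)
    _ = _ := by ring

theorem integrable_eta (hP : ProfileClock c κ η₀ P) (ha : Admissible c κ η₀) :
    Integrable (fun y => profEta κ η₀ (P y)) := by
  refine integrable_of_even_of_integrableOn_Ioi hP.even_eta ?_
  rw [← Ioc_union_Ioi_eq_Ioi (hP.crossingPoint_pos ha).le]
  refine (hP.continuous_eta ha).integrableOn_Ioc.union ?_
  by_cases hκ : κ = 1 / 2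
  · subst hκ
    exact integrableOn_zero.congr_fun (fun x hx =>
      (ha.profEta_half (hP.lt_abs_of_crossingPoint_lt hx).le).symm) measurableSet_Ioi
  · exact hP.integrableOn_eta_outer ha hκ

theorem memLp_eta (hP : ProfileClock c κ η₀ P) (ha : Admissible c κ η₀) :
    MemLp (fun y => profEta κ η₀ (P y)) 2 := by
  have hmeas := (hP.continuous_eta ha).aestronglyMeasurable (μ := volume)
  have hbound : ∀ p, |profEta κ η₀ p| ≤ max (max (etaStar κ) 0) (-η₀) := fun p =>
    abs_le.2 ⟨by linarith [ha.le_profEta p, le_max_right (max (etaStar κ) 0) (-η₀)],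
      (ha.profEta_le p).trans (le_max_left _ _)⟩
  rw [memLp_two_iff_integrable_sq hmeas]
  simp only [pow_two]
  exact (hP.integrable_eta ha).bdd_mul hmeas (ae_of_all _ fun x => hbound (P x))

theorem continuous_fluxRemainder (hP : ProfileClock c κ η₀ P) (ha : Admissible c κ η₀) :
    Continuous (fun y => fluxRemainder c (profEta κ η₀ (P y))) :=
  (continuousOn_fluxRemainder c).comp_continuous (hP.continuous_eta ha)
    fun y => ha.profEta_lt_one (P y)

theorem integrable_eta_mul_fluxRemainder (hP : ProfileClock c κ η₀ P)
    (ha : Admissible c κ η₀) :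
    Integrable (fun y => profEta κ η₀ (P y) * fluxRemainder c (profEta κ η₀ (P y))) := by
  obtain ⟨C, hC⟩ := ha.exists_abs_fluxRemainder_le
  refine (hP.integrable_eta ha).mul_bdd (hP.continuous_fluxRemainder ha).aestronglyMeasurable
    (ae_of_all _ fun x => hC (P x))

/-- The monotone function `q / (1 - η) - ∫ η · fluxRemainder` has derivative `η'² / (2 (1 - η)²)`
and is bounded. -/
theorem integrableOn_sq_slope_div (hP : ProfileClock c κ η₀ P) (ha : Admissible c κ η₀) :
    IntegrableOn (fun y => profSlope c κ η₀ (P y) ^ 2 / (2 * (1 - profEta κ η₀ (P y)) ^ 2))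
      (Ioi 0) := by
  set R := crossingPoint c κ η₀
  have hR := hP.crossingPoint_pos ha
  let E : ℝ → ℝ := fun y => profEta κ η₀ (P y) * fluxRemainder c (profEta κ η₀ (P y))
  have hEc : Continuous E := (hP.continuous_eta ha).mul (hP.continuous_fluxRemainder ha)
  let H : ℝ → ℝ := fun y =>
    profFlux c κ η₀ (P y) / (1 - profEta κ η₀ (P y)) - ∫ t in (0 : ℝ)..y, E t
  have hHc : Continuous H := ((hP.continuous_flux ha).div
    (continuous_const.sub (hP.continuous_eta ha))
      fun x => (sub_pos.2 (ha.profEta_lt_one _)).ne').sub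
    (intervalIntegral.continuous_primitive (fun a b => hEc.intervalIntegrable a b) 0)
  have hH : ∀ x, 0 < x → x ≠ R → HasDerivAt H
      (profSlope c κ η₀ (P x) ^ 2 / (2 * (1 - profEta κ η₀ (P x)) ^ 2)) x := by
    intro x hx hxR
    rw [← abs_of_pos hx] at hxR
    exact ((hasDerivAt_flux_div (hP.hasDerivAt_eta ha hxR) (hP.hasDerivAt_flux ha hx.ne' hxR)
      (diffusion_mul_profSlope c κ η₀ _).symm (ha.profEta_lt_one _)).sub
      (hEc.integral_hasStrictDerivAt 0 x).hasDerivAt).congr_deriv (add_sub_cancel_right _ _)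
  have hlim : Tendsto H atTop (𝓝 (0 / (1 - 0) - ∫ t in Ioi 0, E t)) :=
    (hP.tendsto_flux.div (tendsto_const_nhds.sub hP.tendsto_eta) (by norm_num)).sub
      (intervalIntegral_tendsto_integral_Ioi 0
        (hP.integrable_eta_mul_fluxRemainder ha).integrableOn tendsto_id)
  rw [← Ioc_union_Ioi_eq_Ioi hR.le]
  exact (intervalIntegral.integrableOn_deriv_of_nonneg hHc.continuousOn
    (fun x hx => hH x hx.1 hx.2.ne) fun x _ => by positivity).union
    (integrableOn_Ioi_deriv_of_nonneg hHc.continuousWithinAt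
      (fun x hx => hH x (hR.trans hx) (ne_of_gt hx)) (fun x _ => by positivity) hlim)

theorem memLp_slope (hP : ProfileClock c κ η₀ P) (ha : Admissible c κ η₀) :
    MemLp (fun y => profSlope c κ η₀ (P y)) 2 := by
  have hmeas := hP.measurable_slope ha
  refine (memLp_two_iff_integrable_sq hmeas.aestronglyMeasurable).2 <|
    integrable_of_even_of_integrableOn_Ioi (fun x => by rw [hP.odd_slope, neg_sq]) ?_
  refine ((hP.integrableOn_sq_slope_div ha).const_mul (2 * (1 - η₀) ^ 2)).mono'
    (hmeas.pow_const 2).aestronglyMeasurable (ae_of_all _ fun x => ?_)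
  have h1 := sub_pos.2 (ha.profEta_lt_one (P x))
  have hle := ha.le_profEta (P x)
  rw [Real.norm_of_nonneg (sq_nonneg _), mul_div_assoc', le_div_iff₀ (by positivity), mul_comm]
  gcongr

theorem tendsto_profRate_nhdsLT (hP : ProfileClock c κ η₀ P) (ha : Admissible c κ η₀) :
    Tendsto (fun y => profRate c κ η₀ (P y)) (𝓝[<] crossingPoint c κ η₀) (𝓝[>] 0) := by
  refine tendsto_nhdsWithin_iff.2 ⟨?_, ?_⟩
  · have hlim := (ha.continuous_profRate.comp hP.cont).tendsto (crossingPoint c κ η₀)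
    have hzero : profRate c κ η₀ (P (crossingPoint c κ η₀)) = 0 := by
      have habs := abs_of_pos ha.crossing_pos
      rw [hP.apply_crossingPoint, profRate, if_pos habs.le, ha.profEta_of_eq habs,
        diffusion_etaStar ha.pos, neg_zero, zero_div, Real.sqrt_zero, mul_zero]
    rw [Function.comp_apply, hzero] at hlim
    exact hlim.mono_left nhdsWithin_le_nhds
  · filter_upwards [Ioo_mem_nhdsLT (hP.crossingPoint_pos ha)] with y hy
    refine (profRate_nonneg _).lt_of_ne' fun h => hy.2.ne ?_
    rw [← abs_of_pos hy.1, (hP.abs_eq_iff y).1 (ha.eq_crossing_of_profRate_eq_zero h)]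

theorem not_differentiableAt_eta (hP : ProfileClock c κ η₀ P) (ha : Admissible c κ η₀) {x : ℝ}
    (hx : |x| = crossingPoint c κ η₀) :
    ¬ DifferentiableAt ℝ (fun y => profEta κ η₀ (P y)) x := by
  have hR := hP.crossingPoint_pos ha
  have hcross : ¬ DifferentiableAt ℝ (fun y => profEta κ η₀ (P y)) (crossingPoint c κ η₀) := by
    intro hdiff
    refine not_differentiableWithinAt_of_deriv_tendsto_atTop_Iio _ ?_ hdiff.differentiableWithinAt
    have hlim : Tendsto (fun y => 2 * P y * (profRate c κ η₀ (P y))⁻¹)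
        (𝓝[<] crossingPoint c κ η₀) atTop := by
      refine Tendsto.pos_mul_atTop (C := 2 * crossing κ η₀) (by linarith [ha.crossing_pos]) ?_
        (hP.tendsto_profRate_nhdsLT ha).inv_tendsto_nhdsGT_zero
      rw [← hP.apply_crossingPoint]
      exact ((hP.cont.tendsto _).const_mul 2).mono_left nhdsWithin_le_nhds
    refine hlim.congr' ?_
    filter_upwards [Ioo_mem_nhdsLT hR] with y hy
    have hyR : |y| < crossingPoint c κ η₀ := by rw [abs_of_pos hy.1]; exact hy.2
    exact ((hasDerivAt_profEta_of_lt ((hP.abs_lt_iff y).2 hyR)).comp y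
      (hP.hasDerivAt ha hyR.ne)).deriv.symm
  rcases (abs_eq hR.le).1 hx with rfl | rfl
  · exact hcross
  · intro hdiff
    refine hcross ?_
    rw [show (fun y => profEta κ η₀ (P y)) = (fun y => profEta κ η₀ (P y)) ∘ Neg.neg from
      funext fun y => (hP.even_eta y).symm]
    exact hdiff.comp _ differentiable_neg.differentiableAt

end ProfileClock

theorem HasAEDeriv.inX {u g : ℝ → ℂ} (hu : HasAEDeriv u g) (hg : MemLp g 2 volume)
    (hη : MemLp (eta u) 2 volume) : InX u := by
  refine ⟨hu.continuous, ⟨fun K hK => ?_, g, hu.hasWeakDeriv, fun K _ => hg.restrict K⟩, hη, g,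
    hu.hasWeakDeriv, hg⟩
  rw [memLp_two_iff_integrable_sq_norm hu.continuous.aestronglyMeasurable]
  exact (hu.continuous.norm.pow 2).continuousOn.integrableOn_compact hK

/-- The equation as a first-order system for `u`, its derivative `g` and the vector flux
`W = u' - 2κ⟨u, u'⟩u`, where derivatives are taken in the sense of `HasAEDeriv`. -/
structure IsFirstOrderSolution (c κ : ℝ) (u g W : ℝ → ℂ) : Prop where
  hasAEDeriv : HasAEDeriv u g
  flux_ae_eq : W =ᵐ[volume] fun x => g x - (2 * κ * inner ℝ (u x) (g x)) • u x
  hasAEDeriv_flux : HasAEDeriv W fun x =>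
    -(Complex.I * c * g x + u x * eta u x + (2 * κ * inner ℝ (u x) (g x)) • g x)

theorem IsFirstOrderSolution.isWeakSolution {c κ : ℝ} {u g W : ℝ → ℂ}
    (h : IsFirstOrderSolution c κ u g W) : IsWeakSolution c κ u := by
  refine ⟨g, h.hasAEDeriv.hasWeakDeriv, fun φ hφ hc => ?_⟩
  have hpair := h.hasAEDeriv_flux.inner (HasAEDeriv.of_contDiff hφ)
  have hint := (hpair.locallyIntegrable.integrableOn_isCompact
    hc).integrable_of_forall_notMem_eq_zero fun x hx => by
      rw [image_eq_zero_of_notMem_tsupport hx,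
        image_eq_zero_of_notMem_tsupport fun h => hx (tsupport_deriv_subset h), inner_zero_right,
        inner_zero_right, add_zero]
  have hzero := integral_eq_zero_of_intervalIntegral_eq_sub
    (f := fun x => inner ℝ (W x) (φ x))
    (hc.mono fun x hx hφx => hx (by simp only [hφx, inner_zero_right])) hint hpair.integral_eq_sub
  rw [← neg_eq_zero, ← integral_neg, ← hzero]
  refine integral_congr_ae (h.flux_ae_eq.mono fun x hx => ?_)
  simp only [hx, inner_neg_left, inner_add_left, inner_sub_left, real_inner_smul_left]
  ring

/-- The logarithmic derivative `u' / u` of a wave with `η = 1 - |u|²`, `d = η'` and momentum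
`⟨iu, u'⟩ = c η / 2`. -/
noncomputable def logSlope (c η d : ℝ) : ℂ := (-d + Complex.I * c * η) / (2 * (1 - η))

theorem logSlope_eq (c η d : ℝ) : logSlope c η d =
    ((-d / (2 * (1 - η)) : ℝ) : ℂ) + ((c * η / (2 * (1 - η)) : ℝ) : ℂ) * Complex.I := by
  unfold logSlope
  push_cast
  ring

theorem norm_sq_logSlope (c η d : ℝ) :
    ‖logSlope c η d‖ ^ 2 = (d ^ 2 + c ^ 2 * η ^ 2) / (2 * (1 - η)) ^ 2 := by
  rw [logSlope_eq, ← Complex.normSq_eq_norm_sq, Complex.normSq_add_mul_I, div_pow, div_pow,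
    ← add_div, neg_sq, mul_pow c]

/-- The wave with intensity profile `η` and momentum `c η / 2`. -/
noncomputable def waveOf (c : ℝ) (η : ℝ → ℝ) (x : ℝ) : ℂ :=
  (√(1 - η x) : ℝ) * Complex.exp (Complex.I * (∫ t in (0 : ℝ)..x, c * η t / (2 * (1 - η t)) : ℝ))

section WaveOf

variable {c κ x : ℝ} {η d q : ℝ → ℝ}

theorem norm_sq_waveOf (c : ℝ) (h : η x ≤ 1) : ‖waveOf c η x‖ ^ 2 = 1 - η x := by
  rw [waveOf, norm_mul, mul_comm Complex.I, Complex.norm_exp_ofReal_mul_I, mul_one,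
    Complex.norm_real, Real.norm_of_nonneg (Real.sqrt_nonneg _), Real.sq_sqrt (sub_nonneg.2 h)]

theorem eta_waveOf (c : ℝ) (h : η x ≤ 1) : eta (waveOf c η) x = η x := by
  rw [eta, norm_sq_waveOf c h, sub_sub_cancel]

theorem continuous_phase_deriv (c : ℝ) (hη : Continuous η) (h1 : ∀ x, η x < 1) :
    Continuous fun t => c * η t / (2 * (1 - η t)) :=
  (hη.const_mul c).div ((continuous_const.sub hη).const_mul 2)
    fun x => mul_ne_zero two_ne_zero (sub_pos.2 (h1 x)).ne'

theorem continuous_waveOf (c : ℝ) (hη : Continuous η) (h1 : ∀ x, η x < 1) :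
    Continuous (waveOf c η) := by
  have hphase := intervalIntegral.continuous_primitive
    (fun a b => (continuous_phase_deriv c hη h1).intervalIntegrable (μ := volume) a b) 0
  unfold waveOf
  fun_prop

theorem hasDerivAt_waveOf (c : ℝ) {δ : ℝ} (hη : Continuous η) (h1 : ∀ x, η x < 1)
    (hd : HasDerivAt η δ x) :
    HasDerivAt (waveOf c η) (waveOf c η x * logSlope c (η x) δ) x := by
  have hm : 0 < 1 - η x := sub_pos.2 (h1 x)
  have hphase := (continuous_phase_deriv c hη h1).integral_hasStrictDerivAt 0 x |>.hasDerivAt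
  have hmod := (hd.const_sub 1).sqrt hm.ne'
  refine (hmod.ofReal_comp.mul (hphase.ofReal_comp.const_mul Complex.I).cexp).congr_deriv ?_
  have hs : (√(1 - η x) : ℂ) ≠ 0 := by exact_mod_cast (Real.sqrt_pos.2 hm).ne'
  have hs2 : ((√(1 - η x) : ℝ) : ℂ) ^ 2 = 1 - η x := by exact_mod_cast Real.sq_sqrt hm.le
  have hm' : (1 - η x : ℂ) ≠ 0 := by exact_mod_cast hm.ne'
  unfold waveOf logSlope
  push_cast
  field_simp
  rw [hs2]
  ring

theorem inner_mul_logSlope {z : ℂ} {y : ℝ} (c δ : ℝ) (hz : ‖z‖ ^ 2 = 1 - y) (hy : y ≠ 1) :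
    inner ℝ z (z * logSlope c y δ) = -δ / 2 := by
  have hm : 1 - y ≠ 0 := sub_ne_zero.2 hy.symm
  rw [← Complex.normSq_eq_norm_sq, Complex.normSq_apply] at hz
  rw [Complex.inner, logSlope_eq]
  simp only [Complex.mul_re, Complex.mul_im, Complex.conj_re, Complex.conj_im, Complex.add_re,
    Complex.add_im, Complex.ofReal_re, Complex.ofReal_im, Complex.I_re, Complex.I_im]
  field_simp
  linear_combination (-δ) * hz

theorem mul_logSlope_flux {y : ℝ} (z : ℂ) (c κ δ : ℝ) (hy : y ≠ 1) :
    z * logSlope c y (diffusion κ y * δ) = z * logSlope c y δ + (κ * δ) • z := by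
  have hm : (1 - y : ℂ) ≠ 0 := by exact_mod_cast sub_ne_zero.2 hy.symm
  rw [Complex.real_smul]
  unfold logSlope diffusion
  push_cast
  field_simp
  ring

theorem hasDerivAt_flux_waveOf (hη : Continuous η) (h1 : ∀ x, η x < 1) {δ : ℝ}
    (hd : HasDerivAt η δ x) (hq : HasDerivAt q (fluxDeriv c κ (η x) δ) x)
    (hqd : q x = diffusion κ (η x) * δ) :
    HasDerivAt (fun y => waveOf c η y * logSlope c (η y) (q y))
      (-(Complex.I * c * (waveOf c η x * logSlope c (η x) δ) + waveOf c η x * η x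
        + (-κ * δ) • (waveOf c η x * logSlope c (η x) δ))) x := by
  have hm : (1 - η x : ℂ) ≠ 0 := by exact_mod_cast (sub_pos.2 (h1 x)).ne'
  have hlog := (hq.ofReal_comp.neg.add (hd.ofReal_comp.const_mul (Complex.I * c))).div
    ((hd.ofReal_comp.const_sub 1).const_mul 2) (mul_ne_zero two_ne_zero hm)
  refine ((hasDerivAt_waveOf c hη h1 hd).mul hlog).congr_deriv ?_
  simp only [Pi.add_apply, Pi.neg_apply, Pi.div_apply, logSlope, fluxDeriv, hqd, diffusion,
    Complex.real_smul]
  push_cast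
  linear_combination (norm := skip) waveOf c η x *
    ((c : ℂ) ^ 2 * η x ^ 2 / (4 * (1 - η x) ^ 2) + (c : ℂ) ^ 2 * η x / (2 * (1 - η x))) *
      Complex.I_sq
  field_simp
  ring

theorem memLp_waveOf_deriv (c : ℝ) (hη : Continuous η) {m : ℝ} (hm : m < 1) (h1 : ∀ x, η x ≤ m)
    (hη2 : MemLp η 2 volume) (hdm : Measurable d) (hd2 : MemLp d 2 volume) :
    MemLp (fun x => waveOf c η x * logSlope c (η x) (d x)) 2 volume := by
  have hlt : ∀ x, η x < 1 := fun x => (h1 x).trans_lt hm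
  have hmeas : Measurable fun x => waveOf c η x * logSlope c (η x) (d x) := by
    refine (continuous_waveOf c hη hlt).measurable.mul ?_
    have hηm := hη.measurable
    unfold logSlope
    fun_prop
  rw [memLp_two_iff_integrable_sq_norm hmeas.aestronglyMeasurable]
  refine ((hd2.integrable_sq.add (hη2.integrable_sq.const_mul (c ^ 2))).const_mul
    (1 / (4 * (1 - m)))).mono' (hmeas.norm.pow_const 2).aestronglyMeasurable
    (Eventually.of_forall fun x => ?_)
  have hx : 0 < 1 - η x := sub_pos.2 (hlt x)
  have heq : ‖waveOf c η x * logSlope c (η x) (d x)‖ ^ 2 =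
      1 / (4 * (1 - η x)) * (d x ^ 2 + c ^ 2 * η x ^ 2) := by
    rw [norm_mul, mul_pow, norm_sq_waveOf c (hlt x).le, norm_sq_logSlope]
    field_simp
    norm_num
  have : 0 < 1 - m := sub_pos.2 hm
  rw [Real.norm_of_nonneg (sq_nonneg _), heq]
  refine mul_le_mul_of_nonneg_right ?_ (by positivity)
  exact one_div_le_one_div_of_le (by positivity) (by linarith [h1 x])

theorem isFirstOrderSolution_waveOf {s : Set ℝ} (hs : s.Countable) (hη : Continuous η)
    (h1 : ∀ x, η x < 1) (hη' : ∀ x ∉ s, HasDerivAt η (d x) x)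
    (hq : Continuous q) (hq' : ∀ x ∉ s, HasDerivAt q (fluxDeriv c κ (η x) (d x)) x)
    (hqd : ∀ x, q x = diffusion κ (η x) * d x) (hd : MemLp d 2 volume)
    (hg : MemLp (fun x => waveOf c η x * logSlope c (η x) (d x)) 2 volume) :
    IsFirstOrderSolution c κ (waveOf c η) (fun x => waveOf c η x * logSlope c (η x) (d x))
      (fun x => waveOf c η x * logSlope c (η x) (q x)) := by
  have hu := continuous_waveOf c hη h1
  have hinner : ∀ x, 2 * κ * inner ℝ (waveOf c η x) (waveOf c η x * logSlope c (η x) (d x)) =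
      -κ * d x := fun x => by
    rw [inner_mul_logSlope c _ (norm_sq_waveOf c (h1 x).le) (h1 x).ne]
    ring
  have hgloc := hg.locallyIntegrable one_le_two
  refine ⟨.of_hasDerivAt_off_countable hs hu (fun x hx => hasDerivAt_waveOf c hη h1 (hη' x hx))
    hgloc, .of_forall fun x => ?_, ?_⟩
  · simp only [hinner, hqd, mul_logSlope_flux _ _ _ _ (h1 x).ne]
    rw [neg_mul, neg_smul, sub_neg_eq_add]
  · simp only [hinner, eta_waveOf c (h1 _).le]
    refine .of_hasDerivAt_off_countable hs ?_
      (fun x hx => hasDerivAt_flux_waveOf hη h1 (hη' x hx) (hq' x hx) (hqd x)) ?_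
    · unfold logSlope
      have hm : ∀ x, (2 * (1 - η x) : ℂ) ≠ 0 := fun x =>
        mul_ne_zero two_ne_zero (by exact_mod_cast (sub_pos.2 (h1 x)).ne')
      exact hu.mul (Continuous.div (by fun_prop) (by fun_prop) hm)
    · have hprod : Integrable fun x => (-κ * d x) • (waveOf c η x * logSlope c (η x) (d x)) := by
        simp only [Complex.real_smul]
        exact (hd.const_mul (-κ)).ofReal.integrable_mul hg
      exact (((hgloc.smul (Complex.I * c)).add
        (by fun_prop : Continuous fun x => waveOf c η x * (η x : ℂ)).locallyIntegrable).add
        hprod.locallyIntegrable).neg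

end WaveOf

/-- The wave with the intensity profile of a profile clock. -/
noncomputable def profileWave (c κ η₀ : ℝ) (P : ℝ → ℝ) : ℝ → ℂ :=
  waveOf c fun y => profEta κ η₀ (P y)

theorem mem_singularSet_iff {κ : ℝ} (hκ : 0 < κ) (u : ℝ → ℂ) (x : ℝ) :
    x ∈ singularSet κ u ↔ diffusion κ (eta u x) = 0 := by
  simp only [singularSet, mem_ofPred_eq, eta, diffusion]
  rw [eq_div_iff (by positivity)]
  constructor <;> intro h <;> linarith

theorem Admissible.eta_profileWave {c κ η₀ : ℝ} (ha : Admissible c κ η₀) (P : ℝ → ℝ) (x : ℝ) :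
    eta (profileWave c κ η₀ P) x = profEta κ η₀ (P x) :=
  eta_waveOf c (ha.profEta_lt_one (P x)).le

namespace ProfileClock

variable {c κ η₀ : ℝ} {P : ℝ → ℝ}

theorem mem_pair_iff (hP : ProfileClock c κ η₀ P) (ha : Admissible c κ η₀) {x : ℝ} :
    x ∈ ({crossingPoint c κ η₀, -crossingPoint c κ η₀} : Set ℝ) ↔ |x| = crossingPoint c κ η₀ :=
  (abs_eq (hP.crossingPoint_pos ha).le).symm

theorem memLp_profileWave_deriv (hP : ProfileClock c κ η₀ P) (ha : Admissible c κ η₀) :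
    MemLp (fun x => profileWave c κ η₀ P x *
      logSlope c (profEta κ η₀ (P x)) (profSlope c κ η₀ (P x))) 2 volume :=
  memLp_waveOf_deriv c (hP.continuous_eta ha) ha.max_etaStar_lt_one
    (fun x => ha.profEta_le (P x)) (hP.memLp_eta ha) (hP.measurable_slope ha) (hP.memLp_slope ha)

theorem isFirstOrderSolution (hP : ProfileClock c κ η₀ P) (ha : Admissible c κ η₀) :
    IsFirstOrderSolution c κ (profileWave c κ η₀ P)
      (fun x => profileWave c κ η₀ P x *
        logSlope c (profEta κ η₀ (P x)) (profSlope c κ η₀ (P x)))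
      (fun x => profileWave c κ η₀ P x *
        logSlope c (profEta κ η₀ (P x)) (profFlux c κ η₀ (P x))) := by
  refine isFirstOrderSolution_waveOf
    (toFinite ({0, crossingPoint c κ η₀, -crossingPoint c κ η₀} : Set ℝ)).countable
    (hP.continuous_eta ha) (fun x => ha.profEta_lt_one (P x)) (fun x hx => ?_)
    (hP.continuous_flux ha) (fun x hx => ?_) (fun x => (diffusion_mul_profSlope c κ η₀ (P x)).symm)
    (hP.memLp_slope ha) (hP.memLp_profileWave_deriv ha)
  all_goals rw [mem_insert_iff, not_or, hP.mem_pair_iff ha] at hx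
  · exact hP.hasDerivAt_eta ha hx.2
  · exact hP.hasDerivAt_flux ha hx.1 hx.2

theorem inX_profileWave (hP : ProfileClock c κ η₀ P) (ha : Admissible c κ η₀) :
    InX (profileWave c κ η₀ P) := by
  refine (hP.isFirstOrderSolution ha).hasAEDeriv.inX (hP.memLp_profileWave_deriv ha) ?_
  rw [funext (ha.eta_profileWave P)]
  exact hP.memLp_eta ha

theorem inNX_profileWave (hP : ProfileClock c κ η₀ P) (ha : Admissible c κ η₀) :
    InNX (profileWave c κ η₀ P) := by
  have hpos : 0 < 1 - max (etaStar κ) 0 := sub_pos.2 ha.max_etaStar_lt_one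
  refine ⟨hP.inX_profileWave ha, (Real.sqrt_pos.2 hpos).trans_le (le_ciInf fun x => ?_)⟩
  have hsq : ‖profileWave c κ η₀ P x‖ ^ 2 = 1 - profEta κ η₀ (P x) :=
    norm_sq_waveOf c (ha.profEta_lt_one (P x)).le
  rw [Real.sqrt_le_left (norm_nonneg _), hsq]
  exact sub_le_sub_left (ha.profEta_le (P x)) 1

theorem regularExtrema_profileWave (hP : ProfileClock c κ η₀ P) (ha : Admissible c κ η₀) :
    regularExtrema κ (profileWave c κ η₀ P) = {0} := by
  ext x
  simp only [regularExtrema, mem_ofPred_eq, mem_singleton_iff, mem_singularSet_iff ha.pos,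
    funext (ha.eta_profileWave P)]
  constructor
  · rintro ⟨hD, hextr⟩
    by_contra hx
    have hxR : |x| ≠ crossingPoint c κ η₀ := fun h => by
      rw [ha.profEta_of_eq ((hP.abs_eq_iff x).2 h), diffusion_etaStar ha.pos] at hD
      exact hD rfl
    exact ha.profSlope_ne_zero (hP.apply_ne_zero hx) hD
      (hextr.hasDerivAt_eq_zero (hP.hasDerivAt_eta ha hxR))
  · rintro rfl
    have h0 : |(0 : ℝ)| < crossing κ η₀ := by rw [abs_zero]; exact ha.crossing_pos
    rw [hP.zero]
    refine ⟨(ha.diffusion_profEta_neg h0).ne, Or.inl (.of_forall fun y => ?_)⟩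
    simp only [hP.zero]
    rw [profEta_of_le h0.le, zero_pow two_ne_zero, add_zero]
    exact ha.le_profEta (P y)

theorem eta_profileWave_zero (hP : ProfileClock c κ η₀ P) (ha : Admissible c κ η₀) :
    eta (profileWave c κ η₀ P) 0 = η₀ := by
  rw [ha.eta_profileWave P, hP.zero, profEta_of_le (by rw [abs_zero]; exact ha.crossing_pos.le),
    zero_pow two_ne_zero, add_zero]

theorem isCompositeWave (hP : ProfileClock c κ η₀ P) (ha : Admissible c κ η₀) :
    IsCompositeWave c κ η₀ (profileWave c κ η₀ P) where
  inX := hP.inX_profileWave ha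
  sol := (hP.isFirstOrderSolution ha).isWeakSolution
  extrema := hP.regularExtrema_profileWave ha
  value := hP.eta_profileWave_zero ha

theorem nondiffSet_profileWave (hP : ProfileClock c κ η₀ P) (ha : Admissible c κ η₀) :
    nondiffSet (profileWave c κ η₀ P) = {crossingPoint c κ η₀, -crossingPoint c κ η₀} := by
  ext x
  rw [hP.mem_pair_iff ha]
  constructor
  · intro hx
    by_contra h
    exact hx (hasDerivAt_waveOf c (hP.continuous_eta ha) (fun y => ha.profEta_lt_one (P y))
      (hP.hasDerivAt_eta ha h)).differentiableAt
  · intro hx hd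
    refine hP.not_differentiableAt_eta ha hx ?_
    rw [← funext (ha.eta_profileWave P)]
    exact (hd.norm_sq ℝ).const_sub 1

theorem ncard_nondiffSet_profileWave (hP : ProfileClock c κ η₀ P) (ha : Admissible c κ η₀) :
    (nondiffSet (profileWave c κ η₀ P)).ncard = 2 := by
  rw [hP.nondiffSet_profileWave ha]
  exact ncard_pair (by linarith [hP.crossingPoint_pos ha])

theorem singularSet_profileWave (hP : ProfileClock c κ η₀ P) (ha : Admissible c κ η₀)
    (hκ : κ ≠ 1 / 2) :
    singularSet κ (profileWave c κ η₀ P) = nondiffSet (profileWave c κ η₀ P) := by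
  ext x
  rw [hP.nondiffSet_profileWave ha, mem_singularSet_iff ha.pos, ha.eta_profileWave P,
    ha.diffusion_profEta_eq_zero_iff hκ, hP.abs_eq_iff, hP.mem_pair_iff ha]

theorem hasCompactSupport_eta (hP : ProfileClock c (1 / 2) η₀ P) (ha : Admissible c (1 / 2) η₀) :
    HasCompactSupport (eta (profileWave c (1 / 2) η₀ P)) := by
  set R := crossingPoint c (1 / 2) η₀
  refine .intro (isCompact_Icc (a := -R) (b := R)) fun x hx => ?_
  rw [ha.eta_profileWave P]
  exact ha.profEta_half ((hP.lt_abs_iff x).2 (not_le.1 fun h => hx (abs_le.1 h))).le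

end ProfileClock

theorem ne_half_of_mem_Dtilde {c κ : ℝ} (h : (c, κ) ∈ Dtilde) : κ ≠ 1 / 2 := by
  rcases h with ((h | h) | h) | h
  · exact h.2.2.2.ne
  · exact h.2.ne'
  · exact h.2.2.ne
  · exact h.2.ne'

theorem admissible_of_mem {c κ η₀ : ℝ} (h : (c, κ) ∈ Dtilde ∪ Ccrit)
    (hη : η₀ < min (etaStar κ) 0 - c ^ 2 - 2) : Admissible c κ η₀ := by
  have hsq : √2 ^ 2 = (2 : ℝ) := Real.sq_sqrt zero_le_two
  have hle : 0 ≤ √(2 : ℝ) := Real.sqrt_nonneg 2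
  rcases h with (((⟨hc0, hc, h0, h1⟩ | ⟨hc, h1⟩) | ⟨hc, h0, h1⟩) | ⟨hc, h1⟩) | ⟨-, h1⟩ <;>
    simp only at *
  · exact ⟨h0, fun _ => by nlinarith, fun h => absurd h h1.not_gt, hη⟩
  · exact ⟨by linarith, fun h => absurd h h1.not_gt, fun _ => by nlinarith, hη⟩
  · exact ⟨h0, fun _ => by rw [hc, hsq], fun h => absurd h h1.not_gt, hη⟩
  · exact ⟨by linarith, fun h => absurd h h1.not_gt, fun _ => by rw [hc, hsq], hη⟩
  · exact ⟨by linarith, fun h => absurd h1 h.ne, fun h => absurd h1 h.ne', hη⟩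

theorem hasWeakDeriv_of_forall_integral_inner {W F : ℝ → ℂ} (hW : LocallyIntegrable W volume)
    (hF : LocallyIntegrable F volume)
    (h : ∀ φ : ℝ → ℂ, ContDiff ℝ ∞ φ → HasCompactSupport φ →
      ∫ x, (inner ℝ (φ x) (F x) + inner ℝ (deriv φ x) (W x)) = 0) : HasWeakDeriv W F := by
  refine ⟨hW, hF, fun φ hφ hφc => eq_neg_of_add_eq_zero_left ?_⟩
  have hφW : Integrable (fun x => deriv φ x • W x) :=
    hW.integrable_smul_left_of_hasCompactSupport (hφ.continuous_deriv (by simp)) hφc.deriv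
  have hφF : Integrable (fun x => φ x • F x) :=
    hF.integrable_smul_left_of_hasCompactSupport hφ.continuous hφc
  rw [← integral_add hφW hφF]
  have hsum : Integrable (fun x => deriv φ x • W x + φ x • F x) := hφW.add hφF
  refine ext_inner_left ℝ fun e => ?_
  rw [← integral_inner hsum, inner_zero_right,
    ← h (fun x => φ x • e) (hφ.smul contDiff_const) hφc.smul_right]
  congr 1 with x
  rw [deriv_smul_const (hφ.differentiable (by simp) x)]
  simp only [inner_add_right, real_inner_smul_left, real_inner_smul_right]
  rw [add_comm]

theorem HasWeakDeriv.hasAEDeriv {v g : ℝ → ℂ} (hv : Continuous v) (h : HasWeakDeriv v g) :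
    HasAEDeriv v g := by
  obtain ⟨P, hP, hvP⟩ := h.exists_hasAEDeriv
  rwa [(hv.ae_eq_iff_eq volume hP.continuous).1 hvP]

theorem HasAEDeriv.ae_unique {E : Type*} [NormedAddCommGroup E] [NormedSpace ℝ E]
    [CompleteSpace E] {f f₁ f₂ : ℝ → E} (h₁ : HasAEDeriv f f₁) (h₂ : HasAEDeriv f f₂) :
    f₁ =ᵐ[volume] f₂ := by
  filter_upwards [h₁.ae_hasDerivAt, h₂.ae_hasDerivAt] with x hx₁ hx₂
  exact hx₁.unique hx₂

theorem locallyIntegrable_of_norm_le {W g : ℝ → ℂ} {k : ℝ → ℝ} (hg : LocallyIntegrable g volume)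
    (hk : Continuous k) (hW : AEStronglyMeasurable W volume) (h : ∀ x, ‖W x‖ ≤ k x * ‖g x‖) :
    LocallyIntegrable W volume := by
  refine (hg.continuous_smul hk).mono hW (.of_forall fun x => (h x).trans ?_)
  rw [norm_smul]
  exact mul_le_mul_of_nonneg_right (le_abs_self _) (norm_nonneg _)

theorem locallyIntegrable_inner_smul_left {u g : ℝ → ℂ} (k : ℝ) (hu : Continuous u)
    (hg : LocallyIntegrable g volume) :
    LocallyIntegrable (fun x => (k * inner ℝ (u x) (g x)) • u x) volume := by
  refine locallyIntegrable_of_norm_le (k := fun x => |k| * ‖u x‖ ^ 2) hg (by fun_prop)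
    (((hu.aestronglyMeasurable.inner hg.aestronglyMeasurable).const_mul k).smul
      hu.aestronglyMeasurable) fun x => ?_
  have := norm_inner_le_norm (𝕜 := ℝ) (u x) (g x)
  calc ‖(k * inner ℝ (u x) (g x)) • u x‖ = |k| * ‖inner ℝ (u x) (g x)‖ * ‖u x‖ := by
        rw [norm_smul, norm_mul, Real.norm_eq_abs k]
    _ ≤ |k| * (‖u x‖ * ‖g x‖) * ‖u x‖ := by gcongr
    _ = |k| * ‖u x‖ ^ 2 * ‖g x‖ := by ring

theorem locallyIntegrable_inner_smul_right {u g : ℝ → ℂ} (k : ℝ) (hu : Continuous u)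
    (hg : MemLp g 2 volume) :
    LocallyIntegrable (fun x => (k * inner ℝ (u x) (g x)) • g x) volume := by
  have hsq : LocallyIntegrable (fun x => ((‖g x‖ ^ 2 : ℝ) : ℂ)) volume :=
    (hg.integrable_norm_pow two_ne_zero).ofReal.locallyIntegrable
  refine locallyIntegrable_of_norm_le (k := fun x => |k| * ‖u x‖) hsq (by fun_prop)
    (((hu.aestronglyMeasurable.inner hg.aestronglyMeasurable).const_mul k).smul
      hg.aestronglyMeasurable) fun x => ?_
  have := norm_inner_le_norm (𝕜 := ℝ) (u x) (g x)
  calc ‖(k * inner ℝ (u x) (g x)) • g x‖ = |k| * ‖inner ℝ (u x) (g x)‖ * ‖g x‖ := by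
        rw [norm_smul, norm_mul, Real.norm_eq_abs k]
    _ ≤ |k| * (‖u x‖ * ‖g x‖) * ‖g x‖ := by gcongr
    _ = |k| * ‖u x‖ * ‖((‖g x‖ ^ 2 : ℝ) : ℂ)‖ := by
        rw [Complex.norm_real, norm_pow, norm_norm]; ring

theorem InX.exists_isFirstOrderSolution {c κ : ℝ} {u : ℝ → ℂ} (hX : InX u)
    (h : IsWeakSolution c κ u) :
    ∃ g W, IsFirstOrderSolution c κ u g W ∧ MemLp g 2 volume := by
  obtain ⟨hu, -, -, g', hg', hg'2⟩ := hX
  obtain ⟨g, hg, hweak⟩ := h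
  have hug := hg.hasAEDeriv hu
  have hg2 : MemLp g 2 volume := hg'2.ae_eq ((hg'.hasAEDeriv hu).ae_unique hug)
  have hgloc := hug.locallyIntegrable
  have hη : Continuous (eta u) := by unfold eta; fun_prop
  have hW := hgloc.sub (locallyIntegrable_inner_smul_left (2 * κ) hu hgloc)
  have hF : LocallyIntegrable (fun x => -(Complex.I * c * g x + u x * eta u x
      + (2 * κ * inner ℝ (u x) (g x)) • g x)) volume :=
    (((locallyIntegrable_clm_comp (ContinuousLinearMap.mul ℝ ℂ (Complex.I * c)) hgloc).add
      (by fun_prop : Continuous fun x => u x * (eta u x : ℂ)).locallyIntegrable).add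
      (locallyIntegrable_inner_smul_right (2 * κ) hu hg2)).neg
  have hpair : ∀ φ : ℝ → ℂ, ContDiff ℝ ∞ φ → HasCompactSupport φ →
      ∫ x, (inner ℝ (φ x) (-(Complex.I * c * g x + u x * eta u x
        + (2 * κ * inner ℝ (u x) (g x)) • g x))
        + inner ℝ (deriv φ x) (g x - (2 * κ * inner ℝ (u x) (g x)) • u x)) = 0 := by
    intro φ hφ hφc
    rw [← neg_eq_zero, ← integral_neg, ← hweak φ hφ hφc]
    congr 1 with x
    simp only [inner_neg_right, inner_sub_right, inner_add_right, real_inner_smul_right,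
      real_inner_comm (φ x), real_inner_comm (deriv φ x)]
    ring
  obtain ⟨W, hWF, hWae⟩ := (hasWeakDeriv_of_forall_integral_inner hW hF hpair).exists_hasAEDeriv
  exact ⟨g, W, ⟨hug, hWae.symm, hWF⟩, hg2⟩

theorem abs_sub_le_of_forall_isLocalExtr {f : ℝ → ℝ} {a b v : ℝ} (hf : ContinuousOn f (Icc a b))
    (ha : f a = v) (hext : ∀ z ∈ Ioo a b, IsLocalExtr f z → f z = v) {x : ℝ} (hx : x ∈ Icc a b) :
    |f x - v| ≤ |f b - v| := by
  obtain ⟨z, hz, hmax⟩ := isCompact_Icc.exists_isMaxOn ⟨x, hx⟩ (hf.sub continuousOn_const).abs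
  have hxz : |f x - v| ≤ |f z - v| := hmax hx
  by_cases hzv : f z = v
  · rw [hzv, sub_self, abs_zero] at hxz
    exact hxz.trans (abs_nonneg _)
  rcases hz.2.eq_or_lt with rfl | hzb
  · exact hxz
  have hza : a < z := hz.1.lt_of_ne fun h => hzv (h ▸ ha)
  have hev : ∀ᶠ y in 𝓝 z, |f y - v| ≤ |f z - v| := hmax.isLocalMax (Icc_mem_nhds hza hzb)
  refine absurd (hext z ⟨hza, hzb⟩ ?_) hzv
  rcases lt_or_gt_of_ne hzv with h | h
  · refine Or.inl (hev.mono fun y hy => ?_)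
    rw [abs_of_neg (sub_neg.2 h)] at hy
    linarith [neg_abs_le (f y - v)]
  · refine Or.inr (hev.mono fun y hy => ?_)
    rw [abs_of_pos (sub_pos.2 h)] at hy
    linarith [le_abs_self (f y - v)]

theorem exists_first_eq {f : ℝ → ℝ} {a x v : ℝ} (hf : ContinuousOn f (Icc a x)) (hax : a ≤ x)
    (ha : f a < v) (hx : v ≤ f x) : ∃ b ∈ Ioc a x, f b = v ∧ ∀ y ∈ Ico a b, f y < v := by
  obtain ⟨b, ⟨hb, hbv⟩, hleast⟩ :=
    (isCompact_Icc.of_isClosed_subset (hf.preimage_isClosed_of_isClosed isClosed_Icc isClosed_Ici)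
      inter_subset_left : IsCompact (Icc a x ∩ f ⁻¹' Ici v)).exists_isLeast
      ⟨x, right_mem_Icc.2 hax, hx⟩
  have hlt : ∀ y ∈ Ico a b, f y < v := fun y hy =>
    not_le.1 fun h => (hleast ⟨⟨hy.1, hy.2.le.trans hb.2⟩, h⟩).not_gt hy.2
  obtain ⟨y, hy, hyv⟩ := intermediate_value_Icc hb.1 (hf.mono (Icc_subset_Icc_right hb.2))
    ⟨ha.le, hbv⟩
  obtain rfl : y = b := hy.2.eq_or_lt.resolve_right fun h => (hlt y ⟨hy.1, h⟩).ne hyv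
  exact ⟨y, ⟨hb.1.lt_of_ne fun h => ha.ne (h ▸ hyv), hb.2⟩, hyv, hlt⟩

theorem injOn_of_forall_not_isLocalExtr {f : ℝ → ℝ} {s : Set ℝ} (hs : s.OrdConnected)
    (hf : ContinuousOn f s) (h : ∀ x ∈ interior s, ¬IsLocalExtr f x) : InjOn f s := by
  intro a ha b hb hab
  by_contra hne
  wlog hlt : a < b generalizing a b
  · exact this hb ha hab.symm (Ne.symm hne) ((not_lt.1 hlt).lt_of_ne (Ne.symm hne))
  obtain ⟨z, hz, hext⟩ := exists_isLocalExtr_Ioo hlt (hf.mono (hs.out ha hb)) hab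
  exact h z (interior_mono (hs.out ha hb) (by rwa [interior_Icc])) hext

theorem sqrt_mul_eq_one {A t : ℝ} (ht : 0 ≤ t) (h : A * t ^ 2 = 1) : √A * t = 1 := by
  rw [← Real.sqrt_one, ← h, Real.sqrt_mul' _ (sq_nonneg t), Real.sqrt_sq ht]

theorem not_forall_le_sq {f : ℝ → ℝ} {a k : ℝ} (hf : Integrable fun x => f x ^ 2) (hk : 0 < k) :
    ¬∀ x, a < x → k ≤ f x ^ 2 := fun h =>
  (nonpos_of_le_integrable hf hf (Eventually.of_forall fun x hx _ => h x hx)).not_gt hk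

/-- The first integral of the profile equation in terms of `η` and the flux `q`: it takes the value
`K` exactly where `q² = (1 - 2κ(1 - η)) potential c K η`. -/
noncomputable def energy (c κ η q : ℝ) : ℝ :=
  (q ^ 2 / diffusion κ η - η ^ 2 * outerFactor c η) / (1 - η)

theorem sq_eq_diffusion_mul_potential {c κ η q K : ℝ} (hD : diffusion κ η ≠ 0) (h1 : η < 1)
    (h : energy c κ η q = K) : q ^ 2 = diffusion κ η * potential c K η := by
  rw [energy, div_eq_iff (by linarith), sub_eq_iff_eq_add, div_eq_iff hD] at h
  rw [h, potential]
  ring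

theorem energy_zero_flux (c κ η : ℝ) : energy c κ η 0 = innerLevel c η := by
  simp [energy, innerLevel]

theorem abs_energy_le {c κ η d e : ℝ} (hη : |2 * η| ≤ 1)
    (hkin : 4 * (1 - η) * e = d ^ 2 + c ^ 2 * η ^ 2) :
    |energy c κ η (diffusion κ η * d)| ≤
      4 * (1 + 3 * |κ|) * e + 2 * (3 + c ^ 2) * η ^ 2 := by
  have hη2 := abs_le.1 hη
  have h1 : 0 < 1 - η := by linarith
  have hDle : |diffusion κ η| ≤ 1 + 3 * |κ| := by
    rw [show diffusion κ η = 1 - (2 - 2 * η) * κ by unfold diffusion; ring]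
    refine (abs_sub _ _).trans ?_
    rw [abs_one, abs_mul]
    gcongr
    exact abs_le.2 ⟨by linarith, by linarith⟩
  have hOle : |outerFactor c η| ≤ 3 + c ^ 2 :=
    abs_le.2 ⟨by unfold outerFactor; linarith, by unfold outerFactor; linarith [sq_nonneg c]⟩
  have hde : d ^ 2 ≤ 4 * (1 - η) * e := hkin ▸ le_add_of_nonneg_right (by positivity)
  have henergy : energy c κ η (diffusion κ η * d) =
      (diffusion κ η * d ^ 2 - η ^ 2 * outerFactor c η) / (1 - η) := by
    unfold energy
    field_simp
  rw [henergy, abs_div, abs_of_pos h1, div_le_iff₀ h1]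
  calc |diffusion κ η * d ^ 2 - η ^ 2 * outerFactor c η|
      ≤ |diffusion κ η| * d ^ 2 + η ^ 2 * |outerFactor c η| := by
        refine (abs_sub _ _).trans ?_
        rw [abs_mul, abs_mul, abs_sq, abs_sq]
    _ ≤ (1 + 3 * |κ|) * (4 * (1 - η) * e) + η ^ 2 * (3 + c ^ 2) := by gcongr
    _ ≤ _ := by
      have : 0 ≤ η ^ 2 * (3 + c ^ 2) * (1 - 2 * η) := mul_nonneg (by positivity) (by linarith)
      linarith

/-- The system satisfied by the intensity profile `η = 1 - |u|²` of a finite energy solution, with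
`d = η'`, the flux `q` and the kinetic density `e = |u'|²`. -/
structure ScalarWave (c κ : ℝ) (η d q e : ℝ → ℝ) : Prop where
  hasAEDeriv : HasAEDeriv η d
  flux_ae_eq : q =ᵐ[volume] fun x => diffusion κ (η x) * d x
  hasAEDeriv_flux : HasAEDeriv q fun x =>
    -2 * e x + 2 * κ * d x ^ 2 - c ^ 2 * η x + 2 * (1 - η x) * η x
  kinetic : ∀ᵐ x, 4 * (1 - η x) * e x = d x ^ 2 + c ^ 2 * η x ^ 2
  integrable_sq : Integrable fun x => η x ^ 2
  integrable_kinetic : Integrable e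

namespace ScalarWave

variable {c κ a b x : ℝ} {η d q e : ℝ → ℝ}

theorem continuous (hS : ScalarWave c κ η d q e) : Continuous η := hS.hasAEDeriv.continuous

theorem reflect (hS : ScalarWave c κ η d q e) :
    ScalarWave c κ (fun x => η (-x)) (fun x => -d (-x)) (fun x => -q (-x)) (fun x => e (-x)) where
  hasAEDeriv := hS.hasAEDeriv.comp_neg
  flux_ae_eq := by
    filter_upwards [(Measure.measurePreserving_neg volume).quasiMeasurePreserving.ae
      hS.flux_ae_eq] with x hx
    rw [hx, mul_neg]
  hasAEDeriv_flux := by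
    simpa only [neg_one_smul, neg_neg, neg_sq] using hS.hasAEDeriv_flux.comp_neg.const_smul (-1)
  kinetic := by
    simpa only [neg_sq] using
      (Measure.measurePreserving_neg volume).quasiMeasurePreserving.ae hS.kinetic
  integrable_sq := hS.integrable_sq.comp_neg
  integrable_kinetic := hS.integrable_kinetic.comp_neg

theorem ae_eq_flux_div (hS : ScalarWave c κ η d q e) :
    ∀ᵐ x, diffusion κ (η x) ≠ 0 → d x = q x / diffusion κ (η x) := by
  filter_upwards [hS.flux_ae_eq] with x hx hD
  rw [hx, mul_div_cancel_left₀ _ hD]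

theorem hasDerivAt (hS : ScalarWave c κ η d q e) (hD : diffusion κ (η x) ≠ 0) :
    HasDerivAt η (q x / diffusion κ (η x)) x := by
  have hη := hS.continuous
  have hcont := continuous_diffusion (κ := κ).comp hη
  exact hS.hasAEDeriv.hasDerivAt_of_ae_eq (U := {y | diffusion κ (η y) ≠ 0})
    (isOpen_ne_fun hcont continuous_const)
    (hS.hasAEDeriv_flux.continuous.continuousOn.div hcont.continuousOn fun _ hy => hy)
    hS.ae_eq_flux_div hD

theorem hasDerivAt_flux (hS : ScalarWave c κ η d q e) (hD : diffusion κ (η x) ≠ 0) (h1 : η x < 1) :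
    HasDerivAt q (fluxDeriv c κ (η x) (q x / diffusion κ (η x))) x := by
  have hη := hS.continuous
  have hcont := continuous_diffusion (κ := κ).comp hη
  let U := {y | diffusion κ (η y) ≠ 0 ∧ η y < 1}
  have hd : ContinuousOn (fun y => q y / diffusion κ (η y)) U :=
    hS.hasAEDeriv_flux.continuous.continuousOn.div hcont.continuousOn fun _ hy => hy.1
  have hflux : ContinuousOn (fun y => fluxDeriv c κ (η y) (q y / diffusion κ (η y))) U := by
    have hne : ∀ y ∈ U, 2 * (1 - η y) ≠ 0 := fun y hy => by linarith [hy.2]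
    unfold fluxDeriv
    exact (((((hd.pow 2).add (by fun_prop)).neg.div (by fun_prop) hne).add (by fun_prop)).sub
      (by fun_prop)).add (by fun_prop)
  refine hS.hasAEDeriv_flux.hasDerivAt_of_ae_eq (U := U)
    ((isOpen_ne_fun hcont continuous_const).inter (isOpen_lt hη continuous_const)) hflux ?_ ⟨hD, h1⟩
  filter_upwards [hS.ae_eq_flux_div, hS.kinetic] with y hy hkin hyU
  have hne : 1 - η y ≠ 0 := by linarith [hyU.2]
  rw [← hy hyU.1, fluxDeriv, ← hkin]
  field_simp
  ring

theorem flux_eq_zero_of_isLocalExtr (hS : ScalarWave c κ η d q e) (hD : diffusion κ (η x) ≠ 0)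
    (hext : IsLocalExtr η x) : q x = 0 := by
  simpa [hD] using hext.hasDerivAt_eq_zero (hS.hasDerivAt hD)

theorem hasDerivAt_energy (hS : ScalarWave c κ η d q e) (hD : diffusion κ (η x) ≠ 0)
    (h1 : η x < 1) : HasDerivAt (fun y => energy c κ (η y) (q y)) 0 x := by
  have hη := hS.hasDerivAt hD
  have hq := hS.hasDerivAt_flux hD h1
  have hdiff := (hasDerivAt_diffusion κ (η x)).comp x hη
  have hpot := (hasDerivAt_potential c 0 (η x)).comp x hη
  have h1' : 1 - η x ≠ 0 := by linarith
  have hder := (((hq.pow 2).div hdiff hD).sub hpot).div (hη.const_sub 1) h1'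
  simp only [energy, ← potential_zero_level]
  refine hder.congr_deriv ?_
  simp only [Function.comp_apply, Pi.pow_apply, fluxDeriv, Pi.div_apply, Pi.sub_apply,
    potential_zero_level]
  have hDη : diffusion κ (η x) = 1 - 2 * κ * (1 - η x) := by unfold diffusion; ring
  generalize diffusion κ (η x) = D at *
  field_simp
  rw [hDη, outerFactor]
  ring

theorem energy_eq (hS : ScalarWave c κ η d q e)
    (h : ∀ y ∈ Icc a b, diffusion κ (η y) ≠ 0 ∧ η y < 1) (hx : x ∈ Icc a b) :
    energy c κ (η x) (q x) = energy c κ (η a) (q a) := by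
  have hder : ∀ y ∈ Icc a b, HasDerivAt (fun y => energy c κ (η y) (q y)) 0 y := fun y hy =>
    hS.hasDerivAt_energy (h y hy).1 (h y hy).2
  exact eqOn_of_hasDerivAt_zero_off_countable countable_empty
    (fun y hy => (hder y hy).continuousAt.continuousWithinAt)
    (fun y hy => hder y (Ioo_subset_Icc_self hy.1)) hx

/-- Finite energy forces the constant of integration to vanish along an unbounded regular region:
where `|η| ≤ 1/2`, it is dominated by the integrable function `|u'|² + η²`. -/
theorem energy_eq_zero (hS : ScalarWave c κ η d q e)
    (h : ∀ y, a ≤ y → diffusion κ (η y) ≠ 0 ∧ η y < 1) : energy c κ (η a) (q a) = 0 := by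
  set K := energy c κ (η a) (q a) with hK
  have hsq : Integrable fun x => (2 * η x) ^ 2 := by
    simpa only [mul_pow] using hS.integrable_sq.const_mul (2 ^ 2)
  refine abs_nonpos_iff.1 (nonpos_of_le_integrable (a := a) hsq
    ((hS.integrable_kinetic.const_mul (4 * (1 + 3 * |κ|))).add
      (hS.integrable_sq.const_mul (2 * (3 + c ^ 2)))) ?_)
  filter_upwards [hS.flux_ae_eq, hS.kinetic] with x hq hkin hx hη
  rw [hK, ← hS.energy_eq (fun y hy => h y hy.1) (right_mem_Icc.2 hx.le), hq]
  exact abs_energy_le hη hkin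

end ScalarWave

namespace ProfileClock

variable {c κ η₀ a b x : ℝ} {P : ℝ → ℝ}

/-- Any parameter moving with the speed of the profile is the desingularized one: composed with
the clock it has derivative `1`, even if its speed is unbounded at the endpoints. -/
theorem eq_of_profRate_mul_eq_one (hP : ProfileClock c κ η₀ P) (ha : Admissible c κ η₀)
    {p : ℝ → ℝ} (hp : ContinuousOn p (Icc a b)) (hpa : p a = P a)
    (hd : ∀ x ∈ Ioo a b, ∃ p', HasDerivAt p p' x ∧ profRate c κ η₀ (p x) * p' = 1)
    (hx : x ∈ Icc a b) : p x = P x := by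
  have hcont := ha.continuous_profRate (c := c)
  have hder : ∀ x ∈ Ioo a b \ ∅,
      HasDerivAt (fun x => clock (profRate c κ η₀) (p x) - x) 0 x := fun x hx => by
    obtain ⟨p', hp', hone⟩ := hd x hx.1
    exact (((hasDerivAt_clock hcont _).comp x hp').sub (hasDerivAt_id x)).congr_deriv
      (by rw [hone, sub_self])
  have h := eqOn_of_hasDerivAt_zero_off_countable countable_empty
    (((continuous_clock hcont).comp_continuousOn hp).sub continuousOn_id) hder hx
  simp only [Function.comp_apply, Pi.sub_apply, id, hpa, hP.clock_apply, sub_self] at h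
  rw [← hP.apply_clock (p x), sub_eq_zero.1 h]

end ProfileClock

/-- `η₀ = η(0)` is the only local extremal value of `η` other than the singular value. -/
structure SingleExtremum (κ η₀ : ℝ) (η : ℝ → ℝ) : Prop where
  value : η 0 = η₀
  extr : IsLocalExtr η 0
  unique : ∀ x, IsLocalExtr η x → η x ≠ etaStar κ → x = 0

namespace SingleExtremum

variable {κ η₀ R x y : ℝ} {η : ℝ → ℝ}

theorem reflect (hs : SingleExtremum κ η₀ η) : SingleExtremum κ η₀ (fun x => η (-x)) where
  value := by rw [neg_zero, hs.value]
  extr := (show IsLocalExtr η (-0) by rw [neg_zero]; exact hs.extr).comp_continuous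
    continuous_neg.continuousAt
  unique x hx hne := by
    rw [← neg_neg x] at hx
    have h : IsLocalExtr ((fun x => η (-x)) ∘ Neg.neg) (-x) :=
      hx.comp_continuous continuous_neg.continuousAt
    simp only [Function.comp_def, neg_neg] at h
    exact neg_eq_zero.1 (hs.unique (-x) h hne)

theorem not_isLocalExtr (hs : SingleExtremum κ η₀ η) (hx : x ≠ 0) (hne : η x ≠ etaStar κ) :
    ¬IsLocalExtr η x := fun h => hx (hs.unique x h hne)

theorem abs_sub_etaStar_le (hs : SingleExtremum κ η₀ η) (hη : Continuous η) (hR : 0 < R)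
    (hRη : η R = etaStar κ) (hRx : R ≤ x) (hxy : x ≤ y) :
    |η x - etaStar κ| ≤ |η y - etaStar κ| :=
  abs_sub_le_of_forall_isLocalExtr hη.continuousOn hRη
    (fun z hz hext => by
      by_contra hne
      exact hs.not_isLocalExtr (hR.trans hz.1).ne' hne hext) ⟨hRx, hxy⟩

theorem eq_zero_outside (hs : SingleExtremum (1 / 2) η₀ η) (hη : Continuous η)
    (hsq : Integrable fun x => η x ^ 2) (hR : 0 < R) (hRη : η R = etaStar (1 / 2)) (hx : R ≤ x) :
    η x = 0 := by
  by_contra hne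
  refine not_forall_le_sq (a := x) hsq (sq_pos_of_ne_zero hne) fun y hy => sq_le_sq.2 ?_
  simpa only [etaStar_half, sub_zero] using hs.abs_sub_etaStar_le hη hR hRη hx hy.le

end SingleExtremum

theorem Admissible.regular_of_lt_etaStar {c κ η₀ y : ℝ} (ha : Admissible c κ η₀)
    (hy : y < etaStar κ) : diffusion κ y ≠ 0 ∧ y < 1 := by
  rw [diffusion_eq ha.pos]
  exact ⟨mul_ne_zero (by linarith [ha.pos]) (sub_ne_zero.2 hy.ne),
    hy.trans (etaStar_lt_one ha.pos)⟩

theorem nonneg_of_hasDerivAt_of_monotoneOn {f : ℝ → ℝ} {f' x : ℝ} {s : Set ℝ} (hs : s ∈ 𝓝 x)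
    (hf : MonotoneOn f s) (h : HasDerivAt f f' x) : 0 ≤ f' := by
  rw [← h.deriv, ← derivWithin_of_mem_nhds hs]
  exact hf.derivWithin_nonneg

namespace ScalarWave

variable {c κ η₀ R a b x : ℝ} {η d q e P : ℝ → ℝ}

theorem etaStar_mul_eq_of_plateau (hS : ScalarWave c κ η d q e) (hκ : 0 < κ) (hab : a < b)
    (h : ∀ x ∈ Ioo a b, η x = etaStar κ) :
    etaStar κ * (4 * (1 - etaStar κ) ^ 2) = etaStar κ * (c ^ 2 * (2 - etaStar κ)) := by
  have hderiv : ∀ {f : ℝ → ℝ} {f' v x : ℝ}, (∀ y ∈ Ioo a b, f y = v) → x ∈ Ioo a b →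
      HasDerivAt f f' x → f' = 0 := fun hf hx hf' =>
    hf'.unique ((hasDerivAt_const _ _).congr_of_eventuallyEq
      (eventually_of_mem (isOpen_Ioo.mem_nhds hx) hf))
  have hq : ∀ x ∈ Ioo a b, q x = 0 := by
    refine Measure.eqOn_open_of_ae_eq (μ := volume) ?_ isOpen_Ioo
      hS.hasAEDeriv_flux.continuous.continuousOn (continuousOn_const (c := (0 : ℝ)))
    filter_upwards [ae_restrict_of_ae hS.flux_ae_eq, ae_restrict_mem measurableSet_Ioo]
      with x hx hxI
    rw [hx, h x hxI, diffusion_etaStar hκ, zero_mul]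
  obtain ⟨x, hx, hη', hq', hkin⟩ := (Measure.dense_of_ae (hS.hasAEDeriv.ae_hasDerivAt.and
    (hS.hasAEDeriv_flux.ae_hasDerivAt.and hS.kinetic))).inter_open_nonempty _ isOpen_Ioo
    (nonempty_Ioo.2 hab)
  have hd := hderiv h hx hη'
  have hflux := hderiv hq hx hq'
  rw [hd, h x hx] at hflux hkin
  linear_combination 2 * (1 - etaStar κ) * hflux + hkin

theorem not_plateau (hS : ScalarWave c κ η d q e) (ha : Admissible c κ η₀) (hκ : κ ≠ 1 / 2)
    (hab : a < b) : ¬∀ x ∈ Ioo a b, η x = etaStar κ := fun h => by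
  have hη := mul_left_cancel₀ (etaStar_ne_zero ha.pos hκ)
    (hS.etaStar_mul_eq_of_plateau ha.pos hab h)
  have hpos := ha.pos
  have hc : c ^ 2 * (κ ^ 2 + κ / 2) = 1 := by
    unfold etaStar at hη
    field_simp at hη
    linear_combination -hη / 4
  rcases hκ.lt_or_gt with hlt | hgt
  · nlinarith [ha.sub hlt, sq_nonneg c]
  · nlinarith [ha.super hgt]

theorem energy_zero (hS : ScalarWave c κ η d q e) (hs : SingleExtremum κ η₀ η)
    (ha : Admissible c κ η₀) : energy c κ (η 0) (q 0) = innerLevel c η₀ := by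
  have hD := (ha.regular_of_lt_etaStar (hs.value.trans_lt ha.lt_etaStar)).1
  rw [hS.flux_eq_zero_of_isLocalExtr hD hs.extr, hs.value, energy_zero_flux]

theorem exists_etaStar_le (hS : ScalarWave c κ η d q e) (hs : SingleExtremum κ η₀ η)
    (ha : Admissible c κ η₀) : ∃ x, 0 ≤ x ∧ etaStar κ ≤ η x := by
  by_contra! h
  have hlevel : innerLevel c η₀ = 0 := by
    rw [← hS.energy_zero hs ha]
    exact hS.energy_eq_zero fun y hy => ha.regular_of_lt_etaStar (h y hy)
  have hη₀ := ha.lt_zero.ne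
  have hO : 0 < outerFactor c η₀ := by unfold outerFactor; linarith [ha.lt_neg, sq_nonneg c]
  have : 0 < η₀ ^ 2 * outerFactor c η₀ := by positivity
  rw [innerLevel, div_eq_zero_iff] at hlevel
  rcases hlevel with h | h <;> linarith [ha.lt_zero]

theorem strictMonoOn_inner (hη : Continuous η) (hs : SingleExtremum κ η₀ η)
    (ha : Admissible c κ η₀) (hb : 0 < b) (hηb : η b = etaStar κ)
    (hlt : ∀ x ∈ Ico 0 b, η x < etaStar κ) : StrictMonoOn η (Icc 0 b) := by
  refine ContinuousOn.strictMonoOn_of_injOn_Icc hb.le ?_ hη.continuousOn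
    (injOn_of_forall_not_isLocalExtr ordConnected_Icc hη.continuousOn fun x hx => ?_)
  · rw [hs.value, hηb]
    exact ha.lt_etaStar.le
  · rw [interior_Icc] at hx
    exact hs.not_isLocalExtr hx.1.ne' (hlt x (Ioo_subset_Ico_self hx)).ne

theorem exists_hasDerivAt_sqrt_sub (hS : ScalarWave c κ η d q e) (hs : SingleExtremum κ η₀ η)
    (ha : Admissible c κ η₀) (hηb : η b = etaStar κ) (hlt : ∀ x ∈ Ico 0 b, η x < etaStar κ)
    (hx : x ∈ Ioo 0 b) :
    ∃ p', HasDerivAt (fun y => √(η y - η₀)) p' x ∧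
      profRate c κ η₀ (√(η x - η₀)) * p' = 1 := by
  have hb := hx.1.trans hx.2
  have hmono := strictMonoOn_inner hS.continuous hs ha hb hηb hlt
  have hregular : ∀ y ∈ Icc 0 x, diffusion κ (η y) ≠ 0 ∧ η y < 1 := fun y hy =>
    ha.regular_of_lt_etaStar (hlt y ⟨hy.1, hy.2.trans_lt hx.2⟩)
  obtain ⟨hD, h1⟩ := hregular x (right_mem_Icc.2 hx.1.le)
  have hη₀x : 0 < η x - η₀ := by
    rw [← hs.value]
    exact sub_pos.2 (hmono (left_mem_Icc.2 hb.le) (Ioo_subset_Icc_self hx) hx.1)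
  have hder := hS.hasDerivAt hD
  have hd : 0 ≤ q x / diffusion κ (η x) :=
    nonneg_of_hasDerivAt_of_monotoneOn (Icc_mem_nhds hx.1 hx.2) hmono.monotoneOn hder
  have hfirst := sq_eq_diffusion_mul_potential hD h1
    ((hS.energy_eq hregular (right_mem_Icc.2 hx.1.le)).trans (hS.energy_zero hs ha))
  rw [potential_innerLevel (by linarith [ha.lt_zero])] at hfirst
  have hp : |√(η x - η₀)| ≤ crossing κ η₀ := by
    rw [abs_of_nonneg (Real.sqrt_nonneg _)]
    exact Real.sqrt_le_sqrt (sub_le_sub_right (hlt x (Ioo_subset_Ico_self hx)).le _)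
  refine ⟨_, (hder.sub_const η₀).sqrt hη₀x.ne', ?_⟩
  have hI := ha.innerFactor_pos h1
  rw [profRate, if_pos hp, profEta_of_le hp, Real.sq_sqrt hη₀x.le, add_sub_cancel]
  calc _ = √(-diffusion κ (η x) / innerFactor c η₀ (η x)) *
        (q x / diffusion κ (η x) / √(η x - η₀)) := by ring
    _ = 1 := sqrt_mul_eq_one (by positivity) ?_
  rw [div_pow, div_pow, hfirst, Real.sq_sqrt hη₀x.le]
  field_simp
  ring

theorem eq_profEta_inner (hS : ScalarWave c κ η d q e) (hs : SingleExtremum κ η₀ η)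
    (ha : Admissible c κ η₀) (hP : ProfileClock c κ η₀ P) :
    ∀ x ∈ Icc 0 (crossingPoint c κ η₀), η x = profEta κ η₀ (P x) := by
  obtain ⟨y, hy, hηy⟩ := hS.exists_etaStar_le hs ha
  have hη := hS.continuous
  obtain ⟨b, hb, hηb, hlt⟩ := exists_first_eq hη.continuousOn hy
    (hs.value.trans_lt ha.lt_etaStar) hηy
  have hmono := strictMonoOn_inner hη hs ha hb.1 hηb hlt
  have hsqrt : ∀ x ∈ Icc 0 b, √(η x - η₀) = P x := fun x hx =>
    hP.eq_of_profRate_mul_eq_one ha (by fun_prop)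
      (by rw [hs.value, sub_self, Real.sqrt_zero, hP.zero])
      (fun x hx => hS.exists_hasDerivAt_sqrt_sub hs ha hηb hlt hx) hx
  obtain rfl : b = crossingPoint c κ η₀ := hP.mono.injective <| by
    rw [← hsqrt b (right_mem_Icc.2 hb.1.le), hηb, hP.apply_crossingPoint, crossing]
  intro x hx
  have hη₀x : η₀ ≤ η x := hs.value ▸ hmono.monotoneOn (left_mem_Icc.2 hb.1.le) hx hx.1
  have hp : |P x| ≤ crossing κ η₀ := by
    rw [hP.abs_apply, abs_of_nonneg hx.1, ← hP.apply_crossingPoint]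
    exact hP.mono.monotone hx.2
  rw [profEta_of_le hp, ← hsqrt x hx, Real.sq_sqrt (sub_nonneg.2 hη₀x), add_sub_cancel]

theorem ne_etaStar_outside (hS : ScalarWave c κ η d q e) (hs : SingleExtremum κ η₀ η)
    (ha : Admissible c κ η₀) (hκ : κ ≠ 1 / 2) (hR : 0 < R) (hηR : η R = etaStar κ) (hx : R < x) :
    η x ≠ etaStar κ := fun hηx => hS.not_plateau ha hκ hx fun z hz => by
  have := hs.abs_sub_etaStar_le hS.continuous hR hηR hz.1.le hz.2.le
  rwa [hηx, sub_self, abs_zero, abs_nonpos_iff, sub_eq_zero] at this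

theorem strictAntiOn_outer (hS : ScalarWave c κ η d q e) (hs : SingleExtremum κ η₀ η)
    (ha : Admissible c κ η₀) (hκ : κ ≠ 1 / 2) (hR : 0 < R) (hηR : η R = etaStar κ) :
    StrictAntiOn (fun x => η x / etaStar κ) (Ici R) := by
  have hη := hS.continuous
  have hstar := etaStar_ne_zero ha.pos hκ
  have hinj : InjOn (fun x => η x / etaStar κ) (Ici R) := fun x hx y hy hxy =>
    injOn_of_forall_not_isLocalExtr ordConnected_Ici hη.continuousOn (fun x hx => by
      rw [interior_Ici] at hx
      exact hs.not_isLocalExtr (hR.trans hx).ne' (hS.ne_etaStar_outside hs ha hκ hR hηR hx))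
      hx hy ((div_left_inj' hstar).1 hxy)
  have hcont : Continuous fun x => η x / etaStar κ := hη.div_const _
  have hone : η R / etaStar κ = 1 := by rw [hηR, div_self hstar]
  have hanti : ∀ y, R ≤ y → η y / etaStar κ ≤ 1 →
      StrictAntiOn (fun x => η x / etaStar κ) (Icc R y) := fun y hy hle =>
    ContinuousOn.strictAntiOn_of_injOn_Icc hy (hone.symm ▸ hle) hcont.continuousOn
      (hinj.mono Icc_subset_Ici_self)
  have hle : ∀ x, R ≤ x → η x / etaStar κ ≤ 1 := fun x hx => by
    by_contra! hgt
    refine not_forall_le_sq (a := x) hS.integrable_sq (sq_pos_of_ne_zero hstar) fun y hy => ?_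
    have hy1 : 1 ≤ η y / etaStar κ := by
      by_contra! hlt
      exact hgt.not_ge (((hanti y (hx.trans hy.le) hlt.le).antitoneOn
        (left_mem_Icc.2 (hx.trans hy.le)) ⟨hx, hy.le⟩ hx).trans hone.le)
    have := one_le_pow₀ hy1 (n := 2)
    rwa [div_pow, one_le_div (by positivity)] at this
  exact fun x hx y hy hxy => hanti y hy (hle y hy) ⟨hx, hxy.le⟩ ⟨hy, le_rfl⟩ hxy

theorem outer_ratio_mem (hS : ScalarWave c κ η d q e) (hs : SingleExtremum κ η₀ η)
    (ha : Admissible c κ η₀) (hκ : κ ≠ 1 / 2) (hR : 0 < R) (hηR : η R = etaStar κ) (hx : R < x) :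
    η x / etaStar κ ∈ Ioo 0 1 := by
  have hanti := hS.strictAntiOn_outer hs ha hκ hR hηR
  have hstar := etaStar_ne_zero ha.pos hκ
  refine ⟨?_, ?_⟩
  · by_contra! hle
    have hneg : η (x + 1) / etaStar κ < 0 :=
      (hanti hx.le (hx.trans (lt_add_one x)).le (lt_add_one x)).trans_le hle
    have hne : η (x + 1) ≠ 0 := fun h => by simp [h] at hneg
    refine not_forall_le_sq (a := x + 1) hS.integrable_sq (sq_pos_of_ne_zero hne) fun y hy => ?_
    have hy' : η y / etaStar κ < η (x + 1) / etaStar κ :=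
      hanti (hx.trans (lt_add_one x)).le ((hx.trans (lt_add_one x)).trans hy).le hy
    have hsq : (η (x + 1) / etaStar κ) ^ 2 ≤ (η y / etaStar κ) ^ 2 := by
      nlinarith
    rwa [div_pow, div_pow, div_le_div_iff_of_pos_right (by positivity)] at hsq
  · calc η x / etaStar κ < η R / etaStar κ := hanti (mem_Ici.2 le_rfl) hx.le hx
      _ = 1 := by rw [hηR, div_self hstar]

theorem outer_regular (hS : ScalarWave c κ η d q e) (hs : SingleExtremum κ η₀ η)
    (ha : Admissible c κ η₀) (hκ : κ ≠ 1 / 2) (hR : 0 < R) (hηR : η R = etaStar κ) (hx : R < x) :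
    diffusion κ (η x) ≠ 0 ∧ η x < 1 := by
  obtain ⟨h0, h1⟩ := hS.outer_ratio_mem hs ha hκ hR hηR hx
  rw [← mul_div_cancel₀ (η x) (etaStar_ne_zero ha.pos hκ)]
  exact ⟨right_ne_zero_of_mul (etaStar_mul_mul_diffusion_neg ha.pos hκ h0 h1).ne,
    by linarith [mul_pos h0 (sub_pos.2 (etaStar_lt_one ha.pos))]⟩

theorem exists_hasDerivAt_sub_log (hS : ScalarWave c κ η d q e) (hs : SingleExtremum κ η₀ η)
    (ha : Admissible c κ η₀) (hκ : κ ≠ 1 / 2) (hR : 0 < R) (hηR : η R = etaStar κ) (hx : R < x) :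
    ∃ p', HasDerivAt (fun y => crossing κ η₀ - Real.log (η y / etaStar κ)) p' x ∧
      profRate c κ η₀ (crossing κ η₀ - Real.log (η x / etaStar κ)) * p' = 1 := by
  have hstar := etaStar_ne_zero ha.pos hκ
  have hratio : ∀ y, R < y → η y / etaStar κ ∈ Ioo 0 1 := fun y =>
    hS.outer_ratio_mem hs ha hκ hR hηR
  have hregular : ∀ y, x ≤ y → diffusion κ (η y) ≠ 0 ∧ η y < 1 := fun y hy =>
    hS.outer_regular hs ha hκ hR hηR (hx.trans_le hy)
  obtain ⟨hD, h1⟩ := hregular x le_rfl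
  obtain ⟨h0, hr1⟩ := hratio x hx
  have hp : crossing κ η₀ < crossing κ η₀ - Real.log (η x / etaStar κ) := by
    linarith [Real.log_neg h0 hr1]
  have hp' : crossing κ η₀ < |crossing κ η₀ - Real.log (η x / etaStar κ)| :=
    hp.trans_le (le_abs_self _)
  have hder := (((hS.hasDerivAt hD).div_const (etaStar κ)).log h0.ne').const_sub (crossing κ η₀)
  have hmono : MonotoneOn (fun y => crossing κ η₀ - Real.log (η y / etaStar κ)) (Ioi R) :=
    fun y hy z hz hyz => sub_le_sub_left (Real.log_le_log (hratio z hz).1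
      ((hS.strictAntiOn_outer hs ha hκ hR hηR).antitoneOn (Ioi_subset_Ici_self hy)
        (Ioi_subset_Ici_self hz) hyz)) _
  have hfirst := sq_eq_diffusion_mul_potential hD h1 (hS.energy_eq_zero hregular)
  have hη : η x ≠ 0 := fun h => by simp [h] at h0
  have hO := ha.outerFactor_ne_zero hκ h0
  rw [mul_div_cancel₀ _ hstar] at hO
  refine ⟨_, hder, ?_⟩
  rw [profRate, if_neg hp'.not_ge, if_neg hκ, profEta_of_lt hp',
    abs_of_pos (ha.crossing_pos.trans hp), sub_sub_cancel, Real.exp_log h0,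
    mul_div_cancel₀ _ hstar]
  refine sqrt_mul_eq_one (nonneg_of_hasDerivAt_of_monotoneOn (Ioi_mem_nhds hx) hmono hder) ?_
  rw [potential_zero_level] at hfirst
  field_simp
  linear_combination hfirst

theorem eq_profEta_outer (hS : ScalarWave c κ η d q e) (hs : SingleExtremum κ η₀ η)
    (ha : Admissible c κ η₀) (hP : ProfileClock c κ η₀ P)
    (hηR : η (crossingPoint c κ η₀) = etaStar κ) (hx : crossingPoint c κ η₀ < x) :
    η x = profEta κ η₀ (P x) := by
  have hR := hP.crossingPoint_pos ha
  have hη := hS.continuous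
  have hlt : crossing κ η₀ < |P x| := by
    rw [hP.lt_abs_iff, abs_of_pos (hR.trans hx)]
    exact hx
  by_cases hκ : κ = 1 / 2
  · subst hκ
    rw [hs.eq_zero_outside hη hS.integrable_sq hR hηR hx.le, ha.profEta_half hlt.le]
  have hstar := etaStar_ne_zero ha.pos hκ
  have hone : η (crossingPoint c κ η₀) / etaStar κ = 1 := by rw [hηR, div_self hstar]
  have hratio : ∀ y ∈ Icc (crossingPoint c κ η₀) x, η y / etaStar κ ≠ 0 := fun y hy => by
    rcases hy.1.eq_or_lt with rfl | hy'
    · exact hone.symm ▸ one_ne_zero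
    · exact (hS.outer_ratio_mem hs ha hκ hR hηR hy').1.ne'
  have hcont : ContinuousOn (fun y => crossing κ η₀ - Real.log (η y / etaStar κ))
      (Icc (crossingPoint c κ η₀) x) :=
    continuousOn_const.sub ((hη.div_const _).continuousOn.log hratio)
  have hlog : crossing κ η₀ - Real.log (η x / etaStar κ) = P x :=
    hP.eq_of_profRate_mul_eq_one ha hcont
      (by rw [hone, Real.log_one, sub_zero, hP.apply_crossingPoint])
      (fun y hy => hS.exists_hasDerivAt_sub_log hs ha hκ hR hηR hy.1) (right_mem_Icc.2 hx.le)
  have hPx : 0 < P x := ha.crossing_pos.trans (by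
    rw [← hP.apply_crossingPoint (c := c)]
    exact hP.mono hx)
  rw [profEta_of_lt hlt, abs_of_pos hPx, ← hlog, sub_sub_cancel,
    Real.exp_log (hS.outer_ratio_mem hs ha hκ hR hηR hx).1, mul_div_cancel₀ _ hstar]

theorem eq_profEta (hS : ScalarWave c κ η d q e) (hs : SingleExtremum κ η₀ η)
    (ha : Admissible c κ η₀) (hP : ProfileClock c κ η₀ P) (x : ℝ) :
    η x = profEta κ η₀ (P x) := by
  have hnonneg : ∀ {η d q e : ℝ → ℝ}, ScalarWave c κ η d q e → SingleExtremum κ η₀ η →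
      ∀ {x}, 0 ≤ x → η x = profEta κ η₀ (P x) := fun {η d q e} hS hs {x} hx => by
    have hinner := hS.eq_profEta_inner hs ha hP
    rcases le_or_gt x (crossingPoint c κ η₀) with hle | hlt
    · exact hinner x ⟨hx, hle⟩
    refine hS.eq_profEta_outer hs ha hP ?_ hlt
    rw [hinner _ (right_mem_Icc.2 (hP.crossingPoint_pos ha).le), hP.apply_crossingPoint,
      ha.profEta_of_eq (abs_of_pos ha.crossing_pos)]
  rcases le_total 0 x with hx | hx
  · exact hnonneg hS hs hx
  · have := hnonneg hS.reflect hs.reflect (neg_nonneg.2 hx)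
    rwa [neg_neg, hP.odd, profEta_neg] at this

end ScalarWave

section Components

variable (z w : ℂ)

theorem inner_I_mul_left : inner ℝ (Complex.I * z) w = z.re * w.im - z.im * w.re := by
  rw [Complex.inner]
  simp only [Complex.mul_re, Complex.mul_im, Complex.conj_re, Complex.conj_im, Complex.I_re,
    Complex.I_im]
  ring

theorem inner_eq_re_add_im : inner ℝ z w = z.re * w.re + z.im * w.im := by
  rw [Complex.inner, Complex.mul_re, Complex.conj_re, Complex.conj_im]
  ring

theorem inner_mul_I_mul_right (c : ℝ) :
    inner ℝ z (Complex.I * c * w) = -(c * inner ℝ (Complex.I * z) w) := by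
  rw [inner_I_mul_left, inner_eq_re_add_im]
  simp only [Complex.mul_re, Complex.mul_im, Complex.I_re, Complex.I_im, Complex.ofReal_re,
    Complex.ofReal_im]
  ring

theorem norm_sq_mul_norm_sq :
    ‖z‖ ^ 2 * ‖w‖ ^ 2 = inner ℝ z w ^ 2 + inner ℝ (Complex.I * z) w ^ 2 := by
  rw [inner_I_mul_left, inner_eq_re_add_im, ← Complex.normSq_eq_norm_sq,
    ← Complex.normSq_eq_norm_sq, Complex.normSq_apply, Complex.normSq_apply]
  ring

theorem norm_sq_smul_eq : (‖z‖ ^ 2 : ℂ) * w =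
    z * (inner ℝ z w + inner ℝ (Complex.I * z) w * Complex.I) := by
  rw [inner_I_mul_left, inner_eq_re_add_im, ← Complex.ofReal_pow, ← Complex.normSq_eq_norm_sq,
    Complex.normSq_apply]
  apply Complex.ext <;>
    simp only [Complex.mul_re, Complex.mul_im, Complex.add_re, Complex.add_im, Complex.ofReal_re,
      Complex.ofReal_im, Complex.I_re, Complex.I_im] <;> ring

end Components

namespace IsFirstOrderSolution

variable {c κ : ℝ} {u g W : ℝ → ℂ}

theorem hasAEDeriv_eta (h : IsFirstOrderSolution c κ u g W) :
    HasAEDeriv (eta u) fun x => -2 * inner ℝ (u x) (g x) := by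
  convert (HasAEDeriv.const (1 : ℝ)).sub (h.hasAEDeriv.inner h.hasAEDeriv) using 2 with x x
  · rw [eta, real_inner_self_eq_norm_sq]
  · rw [real_inner_comm]
    ring

theorem inner_flux_ae_eq (h : IsFirstOrderSolution c κ u g W) :
    ∀ᵐ x, inner ℝ (u x) (W x) = diffusion κ (eta u x) * inner ℝ (u x) (g x) := by
  filter_upwards [h.flux_ae_eq] with x hx
  rw [hx, inner_sub_right, real_inner_smul_right, real_inner_self_eq_norm_sq, diffusion, eta]
  ring

theorem momentum_ae_eq (h : IsFirstOrderSolution c κ u g W) :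
    ∀ᵐ x, inner ℝ (Complex.I * u x) (W x) = inner ℝ (Complex.I * u x) (g x) := by
  filter_upwards [h.flux_ae_eq] with x hx
  rw [hx, inner_sub_right, real_inner_smul_right, inner_I_mul_left (u x) (u x)]
  ring

theorem momentum_sub_eq (h : IsFirstOrderSolution c κ u g W) (x y : ℝ) :
    inner ℝ (Complex.I * u x) (W x) - c / 2 * eta u x =
      inner ℝ (Complex.I * u y) (W y) - c / 2 * eta u y := by
  have hI := h.hasAEDeriv.clm_comp (ContinuousLinearMap.mul ℝ ℂ Complex.I)
  refine ((hI.inner h.hasAEDeriv_flux).sub (h.hasAEDeriv_eta.const_smul (c / 2))).eq_of_ae_eq_zero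
    ?_ x y
  filter_upwards [h.flux_ae_eq] with x hx
  have hflux : inner ℝ (Complex.I * g x) (W x) =
      2 * κ * inner ℝ (u x) (g x) * inner ℝ (Complex.I * u x) (g x) := by
    rw [hx, inner_sub_right, real_inner_smul_right]
    simp only [inner_I_mul_left]
    ring
  have hrot : inner ℝ (Complex.I * u x) (Complex.I * c * g x) = c * inner ℝ (u x) (g x) := by
    rw [inner_mul_I_mul_right, ← mul_assoc, Complex.I_mul_I, neg_one_mul, inner_neg_left]
    ring
  have hself : inner ℝ (Complex.I * u x) (u x * eta u x) = 0 := by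
    rw [mul_comm (u x), ← Complex.real_smul, real_inner_smul_right, inner_I_mul_left]
    ring
  simp only [ContinuousLinearMap.mul_apply', hflux, inner_neg_right, inner_add_right,
    real_inner_smul_right, hrot, hself, smul_eq_mul, Pi.zero_apply]
  ring

theorem momentum_eq (h : IsFirstOrderSolution c κ u g W) (hη : Integrable fun x => eta u x ^ 2)
    (hg : MemLp g 2 volume) (x : ℝ) :
    inner ℝ (Complex.I * u x) (W x) = c / 2 * eta u x := by
  set C := inner ℝ (Complex.I * u x) (W x) - c / 2 * eta u x with hC
  have hint : Integrable fun y => 4 * ‖g y‖ ^ 2 + c ^ 2 / 2 * eta u y ^ 2 :=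
    (hg.norm.integrable_sq.const_mul 4).add (hη.const_mul (c ^ 2 / 2))
  have hle : C ^ 2 ≤ 0 := by
    refine nonpos_of_le_integrable (a := 0) hη hint ?_
    filter_upwards [h.momentum_ae_eq] with y hy _ hηy
    have hCy : inner ℝ (Complex.I * u y) (g y) = C + c / 2 * eta u y := by
      rw [← hy, hC, h.momentum_sub_eq x y]
      ring
    have hcs := norm_sq_mul_norm_sq (u y) (g y)
    have hu : ‖u y‖ ^ 2 ≤ 2 := by
      have := (abs_le.1 hηy).1
      rw [eta] at this
      linarith
    have hug : ‖u y‖ ^ 2 * ‖g y‖ ^ 2 ≤ 2 * ‖g y‖ ^ 2 := by gcongr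
    rw [hCy] at hcs
    nlinarith [sq_nonneg (inner ℝ (u y) (g y)), sq_nonneg (C + c * eta u y)]
  linarith [pow_eq_zero_iff two_ne_zero |>.1 (le_antisymm hle (sq_nonneg C))]

theorem scalarWave (h : IsFirstOrderSolution c κ u g W) (hη : Integrable fun x => eta u x ^ 2)
    (hg : MemLp g 2 volume) :
    ScalarWave c κ (eta u) (fun x => -2 * inner ℝ (u x) (g x)) (fun x => -2 * inner ℝ (u x) (W x))
      (fun x => ‖g x‖ ^ 2) where
  hasAEDeriv := h.hasAEDeriv_eta
  flux_ae_eq := by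
    filter_upwards [h.inner_flux_ae_eq] with x hx
    rw [hx]
    ring
  hasAEDeriv_flux := by
    refine ((h.hasAEDeriv.inner h.hasAEDeriv_flux).const_smul (-2)).congr_ae ?_
    filter_upwards [h.flux_ae_eq, h.momentum_ae_eq] with x hW hJ
    have hrot : inner ℝ (u x) (Complex.I * c * g x) = -(c ^ 2 / 2 * eta u x) := by
      rw [inner_mul_I_mul_right, ← hJ, h.momentum_eq hη hg]
      ring
    have hself : inner ℝ (u x) (u x * eta u x) = (1 - eta u x) * eta u x := by
      rw [mul_comm (u x), ← Complex.real_smul, real_inner_smul_right, real_inner_self_eq_norm_sq,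
        eta, sub_sub_cancel, mul_comm]
    rw [hW, inner_sub_right, inner_neg_right, inner_add_right, inner_add_right, hrot, hself,
      real_inner_smul_right, real_inner_smul_right, real_inner_self_eq_norm_sq,
      real_inner_comm (u x) (g x), smul_eq_mul]
    ring
  kinetic := by
    filter_upwards [h.momentum_ae_eq] with x hJ
    rw [h.momentum_eq hη hg] at hJ
    have := norm_sq_mul_norm_sq (u x) (g x)
    rw [← hJ] at this
    rw [eta] at this ⊢
    linear_combination 4 * this
  integrable_sq := hη
  integrable_kinetic := hg.norm.integrable_sq

theorem deriv_ae_eq (h : IsFirstOrderSolution c κ u g W) (hη : Integrable fun x => eta u x ^ 2)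
    (hg : MemLp g 2 volume) (hne : ∀ x, u x ≠ 0) :
    ∀ᵐ x, g x = u x * logSlope c (eta u x) (-2 * inner ℝ (u x) (g x)) := by
  filter_upwards [h.momentum_ae_eq] with x hJ
  rw [h.momentum_eq hη hg] at hJ
  have hnorm : (‖u x‖ : ℂ) ≠ 0 := Complex.ofReal_ne_zero.2 (norm_ne_zero_iff.2 (hne x))
  have hη1 : (1 - eta u x : ℂ) = ‖u x‖ ^ 2 := by
    rw [eta]
    push_cast
    ring
  refine mul_left_cancel₀ (pow_ne_zero 2 hnorm) ?_
  rw [norm_sq_smul_eq, ← hJ, logSlope, hη1]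
  push_cast
  field_simp

end IsFirstOrderSolution

theorem Admissible.continuousAt_profSlope {c κ η₀ p : ℝ} (ha : Admissible c κ η₀)
    (hp : |p| ≠ crossing κ η₀) : ContinuousAt (profSlope c κ η₀) p := by
  by_cases hD : diffusion κ (profEta κ η₀ p) = 0
  · obtain rfl : κ = 1 / 2 := by_contra fun hκ => hp ((ha.diffusion_profEta_eq_zero_iff hκ p).1 hD)
    have hout : crossing (1 / 2) η₀ < |p| :=
      hp.lt_or_gt.resolve_left fun hlt => (ha.diffusion_profEta_neg hlt).ne hD
    have hzero : profSlope c (1 / 2) η₀ =ᶠ[𝓝 p] fun _ => 0 := by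
      filter_upwards [continuous_abs.continuousAt.eventually (lt_mem_nhds hout)] with r hr
      rw [profSlope, ha.profFlux_half hr.le, zero_div]
    exact continuousAt_const.congr hzero.symm
  · exact ha.continuous_profFlux.continuousAt.div
      (continuous_diffusion.comp ha.continuous_profEta).continuousAt hD

namespace IsCompositeWave

variable {c κ η₀ : ℝ} {u v : ℝ → ℂ} {P : ℝ → ℝ}

theorem singleExtremum (hκ : 0 < κ) (hu : IsCompositeWave c κ η₀ u) :
    SingleExtremum κ η₀ (eta u) where
  value := hu.value
  extr := (hu.extrema.ge (mem_singleton 0)).2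
  unique x hx hne := by
    refine hu.extrema.le ⟨fun hs => hne ?_, hx⟩
    rw [mem_singularSet_iff hκ, diffusion_eq hκ] at hs
    exact sub_eq_zero.1 ((mul_eq_zero.1 hs).resolve_left (by positivity))

theorem eta_eq_profEta (ha : Admissible c κ η₀) (hP : ProfileClock c κ η₀ P)
    (hu : IsCompositeWave c κ η₀ u) (x : ℝ) : eta u x = profEta κ η₀ (P x) := by
  obtain ⟨g, W, h, hg⟩ := hu.inX.exists_isFirstOrderSolution hu.sol
  exact (h.scalarWave hu.inX.2.2.1.integrable_sq hg).eq_profEta (hu.singleExtremum ha.pos) ha hP x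

theorem ne_zero (ha : Admissible c κ η₀) (hP : ProfileClock c κ η₀ P)
    (hu : IsCompositeWave c κ η₀ u) (x : ℝ) : u x ≠ 0 := fun h0 => by
  have hlt := ha.profEta_lt_one (P x)
  rw [← hu.eta_eq_profEta ha hP, eta, h0, norm_zero] at hlt
  norm_num at hlt

theorem hasDerivAt (ha : Admissible c κ η₀) (hP : ProfileClock c κ η₀ P)
    (hu : IsCompositeWave c κ η₀ u) {x : ℝ} (hx : |x| ≠ crossingPoint c κ η₀) :
    HasDerivAt u (u x * logSlope c (profEta κ η₀ (P x)) (profSlope c κ η₀ (P x))) x := by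
  obtain ⟨g, W, h, hg⟩ := hu.inX.exists_isFirstOrderSolution hu.sol
  have hη : eta u = fun x => profEta κ η₀ (P x) := funext (hu.eta_eq_profEta ha hP)
  refine h.hasAEDeriv.hasDerivAt_of_ae_eq (U := {y | |y| ≠ crossingPoint c κ η₀})
    (g := fun y => u y * logSlope c (profEta κ η₀ (P y)) (profSlope c κ η₀ (P y)))
    (isOpen_ne_fun continuous_abs continuous_const) (fun y hy => ?_) ?_ hx
  · have hslope : ContinuousAt (fun y => profSlope c κ η₀ (P y)) y :=
      (ha.continuousAt_profSlope (mt (hP.abs_eq_iff y).1 hy)).comp hP.cont.continuousAt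
    have hne : (2 * (1 - (profEta κ η₀ (P y) : ℂ))) ≠ 0 := by
      norm_cast
      linarith [ha.profEta_lt_one (P y)]
    have hprof := (hP.continuous_eta ha).continuousAt (x := y)
    exact (hu.inX.1.continuousAt.mul ((by fun_prop : ContinuousAt _ y).div (by fun_prop)
      hne)).continuousWithinAt
  · filter_upwards [h.deriv_ae_eq hu.inX.2.2.1.integrable_sq hg (hu.ne_zero ha hP),
      h.hasAEDeriv_eta.ae_hasDerivAt] with y hgy hdy hy
    rw [hη] at hdy
    rw [hgy, hdy.unique (hP.hasDerivAt_eta ha hy), hu.eta_eq_profEta ha hP]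

theorem eq_phase_mul (ha : Admissible c κ η₀) (hP : ProfileClock c κ η₀ P)
    (hu : IsCompositeWave c κ η₀ u) (hv : IsCompositeWave c κ η₀ v) :
    ∃ ϕ : ℝ, ∀ x, v x = Complex.exp (Complex.I * ϕ) * u x := by
  have hne := hu.ne_zero ha hP
  have hquot : ∀ x ∉ ({crossingPoint c κ η₀, -crossingPoint c κ η₀} : Set ℝ),
      HasDerivAt (fun x => v x / u x) 0 x := fun x hx => by
    rw [hP.mem_pair_iff ha] at hx
    refine ((hv.hasDerivAt ha hP hx).fun_div (hu.hasDerivAt ha hP hx) (hne x)).congr_deriv ?_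
    exact div_eq_zero_iff.2 (.inl (by ring))
  have hleft : ∀ {a b x : ℝ}, x ∈ Icc a b → v x / u x = v a / u a := fun hx =>
    eqOn_of_hasDerivAt_zero_off_countable (toFinite _).countable
      (hv.inX.1.div hu.inX.1 hne).continuousOn (fun y hy => hquot y hy.2) hx
  have hconst : ∀ x, v x / u x = v 0 / u 0 := fun x => by
    rcases le_total 0 x with hx | hx
    · exact hleft ⟨hx, le_rfl⟩
    · exact (hleft ⟨hx, le_rfl⟩).symm
  have hnorm : ‖v 0 / u 0‖ = 1 := by
    have hη : eta v 0 = eta u 0 := hv.value.trans hu.value.symm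
    rw [eta, eta, sub_right_inj, sq_eq_sq₀ (norm_nonneg _) (norm_nonneg _)] at hη
    rw [norm_div, hη, div_self (norm_ne_zero_iff.2 (hne 0))]
  refine ⟨(v 0 / u 0).arg, fun x => ?_⟩
  have hpolar := Complex.norm_mul_exp_arg_mul_I (v 0 / u 0)
  rw [hnorm, Complex.ofReal_one, one_mul] at hpolar
  rw [mul_comm Complex.I, hpolar, ← hconst x, div_mul_cancel₀ _ (hne x)]

end IsCompositeWave

end QuasilinearGP

theorem proposition1p8 (c κ : ℝ)
    (h : (c, κ) ∈ QuasilinearGP.Dtilde ∪ QuasilinearGP.Ccrit) :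
    ∃ A : ℝ, A < 0 ∧ A < 1 - 1 / (2 * κ) ∧ ∀ η₀ : ℝ, η₀ < A →
      ∃ u : ℝ → ℂ, QuasilinearGP.IsCompositeWave c κ η₀ u ∧
        (∀ v : ℝ → ℂ, QuasilinearGP.IsCompositeWave c κ η₀ v →
          ∃ ϕ : ℝ, ∀ x : ℝ, v x = Complex.exp (Complex.I * (ϕ : ℂ)) * u x) ∧
        QuasilinearGP.InNX u ∧
        (∀ x : ℝ, η₀ ≤ QuasilinearGP.eta u x) ∧
        (QuasilinearGP.nondiffSet u).ncard = 2 ∧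
        ((c, κ) ∈ QuasilinearGP.Dtilde →
          QuasilinearGP.singularSet κ u = QuasilinearGP.nondiffSet u) ∧
        ((c, κ) ∈ QuasilinearGP.Ccrit → HasCompactSupport (QuasilinearGP.eta u)) := by
  have hmin_le_star := min_le_left (QuasilinearGP.etaStar κ) 0
  have hmin_le_zero := min_le_right (QuasilinearGP.etaStar κ) 0
  have hstar : QuasilinearGP.etaStar κ = 1 - 1 / (2 * κ) := rfl
  refine ⟨min (QuasilinearGP.etaStar κ) 0 - c ^ 2 - 2, by linarith [sq_nonneg c],
    by linarith [sq_nonneg c], fun η₀ hη => ?_⟩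
  have ha := QuasilinearGP.admissible_of_mem h hη
  obtain ⟨P, hP⟩ := ha.exists_profileClock
  have hu := hP.isCompositeWave ha
  refine ⟨QuasilinearGP.profileWave c κ η₀ P, hu, fun v hv => hu.eq_phase_mul ha hP hv,
    hP.inNX_profileWave ha, fun x => ?_, hP.ncard_nondiffSet_profileWave ha,
    fun hD => hP.singularSet_profileWave ha (QuasilinearGP.ne_half_of_mem_Dtilde hD), fun hC => ?_⟩
  · rw [ha.eta_profileWave P]
    exact ha.le_profEta (P x)
  · obtain rfl : κ = 1 / 2 := hC.2
    exact hP.hasCompactSupport_eta ha
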